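/- Let $m\ge 2$ and let $H\le \mathrm{Sym}(m)$ be a transitive subgroup; write $d(H)$ for the minimal number of generators of $H$. Let $T_m$ be the $m$-adic rooted tree, whose vertices are the finite words over $\{1,\dots,m\}$, and let $\mathrm{Aut}\,T_m$ be the group of graph automorphisms of $T_m$ fixing the root. The label of $g\in\mathrm{Aut}\,T_m$ at a vertex $v$ is the permutation $\sigma\in\mathrm{Sym}(m)$ such that $g$ maps $vx$ to $g(v)\sigma(x)$ for every letter $x$, and $$W_H:=\{g\in\mathrm{Aut}\,T_m \mid \text{the label of } g \text{ at } v \text{ belongs to } H \text{ for every vertex } v\}.$$ Let $\mathrm{St}_{W_H}(n)$ be the subgroup of those elements of $W_H$ that fix all vertices of level $n$. Endow $W_H$ with the topology having these subgroups as a basis of neighbourhoods of the identity, and for a closed subgroup $L\le W_H$ let $$\mathrm{hdim}_{W_H}(L)=\liminf_{n\to\infty}\frac{\log|L\,\mathrm{St}_{W_H}(n):\mathrm{St}_{W_H}(n)|}{\log|W_H:\mathrm{St}_{W_H}(n)|}$$ be its Hausdorff dimension in $W_H$ with respect to the level-stabilizer filtration. Then there is a subgroup $K\le W_H$ generated by $d(H)+1$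 elements whose closure $\overline K$ in $W_H$ satisfies $\mathrm{hdim}_{W_H}(\overline K)=1$. -/

import Mathlib

/-- The `m`-adic rooted tree: vertices are finite words over an alphabet of `m` letters, the root is
the empty word, and each word `u` is joined to its descendants `u ++ [x]`. -/
def treeGraph (m : ℕ) : SimpleGraph (List (Fin m)) where
  Adj u v := (∃ x, v = u ++ [x]) ∨ (∃ x, u = v ++ [x])
  symm := ⟨fun _ _ h => h.symm⟩
  loopless := ⟨fun u h => by
    rcases h with ⟨x, hx⟩ | ⟨x, hx⟩ <;> simpa using congrArg List.length hx⟩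

/-- `Aut T_m`: the group of graph automorphisms of the `m`-adic tree that fix the root. -/
def AutTree (m : ℕ) : Subgroup (Equiv.Perm (List (Fin m))) where
  carrier := {g | g [] = [] ∧ ∀ u v, (treeGraph m).Adj (g u) (g v) ↔ (treeGraph m).Adj u v}
  one_mem' := ⟨rfl, fun _ _ => Iff.rfl⟩
  mul_mem' := by
    rintro g h ⟨hg, hg'⟩ ⟨hh, hh'⟩
    refine ⟨?_, fun u v => ?_⟩
    · simp [hg, hh]
    · simp [hg', hh']
  inv_mem' := by
    rintro g ⟨hg, hg'⟩
    refine ⟨?_, fun u v => ?_⟩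
    · rw [Equiv.Perm.inv_eq_iff_eq, hg]
    · rw [← hg']
      simp

namespace AutTree

/-- Tree automorphisms preserve the levels of the tree. -/
theorem length_apply {m : ℕ} (g : AutTree m) (u : List (Fin m)) :
    (g.1 u).length = u.length := by
  obtain ⟨g, hg0, hg⟩ := g
  induction u using List.reverseRecOn with
  | nil => simp [hg0]
  | append_singleton v x ih =>
    have hadj : (treeGraph m).Adj (g v) (g (v ++ [x])) := (hg _ _).2 (Or.inl ⟨x, rfl⟩)
    rcases hadj with ⟨y, hy⟩ | ⟨y, hy⟩
    · simp only [] at ih ⊢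
      rw [hy]
      simp [ih]
    · exfalso
      rcases List.eq_nil_or_concat v with rfl | ⟨w, z, rfl⟩
      · simp [hg0] at hy
      · rw [List.concat_eq_append] at hy ih
        have hwv : (treeGraph m).Adj (g w) (g (w ++ [z])) := (hg _ _).2 (Or.inl ⟨z, rfl⟩)
        rcases hwv with ⟨t, ht⟩ | ⟨t, ht⟩
        · have he := (List.append_inj' (ht.symm.trans hy) rfl).1
          have := congrArg List.length (g.injective he)
          simp at this
        · -- here the image of `w` would lie two levels below that of its grandchild
          have hb : ∀ u : List (Fin m), (g u).length ≤ u.length := by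
            intro u
            induction u using List.reverseRecOn with
            | nil => simp [hg0]
            | append_singleton a b iha =>
              rcases (hg a (a ++ [b])).2 (Or.inl ⟨b, rfl⟩) with ⟨y, hy⟩ | ⟨y, hy⟩
              · rw [hy]; simpa using iha
              · have := congrArg List.length hy
                simp at this ⊢
                omega
          have h1 := hb w
          have h2 := congrArg List.length ht
          simp at ih h2
          omega

/-- The `n`th level stabilizer `St(n)`: automorphisms fixing every vertex of level `n`. -/
def levelStabilizer (m n : ℕ) : Subgroup (AutTree m) where
  carrier := {g | ∀ u : List (Fin m), u.length = n → g.1 u = u}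
  one_mem' := fun _ _ => rfl
  mul_mem' := by
    intro g h hg hh u hu
    simp [hh u hu, hg u hu]
  inv_mem' := by
    intro g hg u hu
    simp only [InvMemClass.coe_inv]
    rw [Equiv.Perm.inv_eq_iff_eq, hg u hu]

instance levelStabilizer_normal (m n : ℕ) : (levelStabilizer m n).Normal where
  conj_mem := by
    intro g hg a u hu
    have := hg ((a⁻¹ : AutTree m).1 u) (by rw [length_apply, hu])
    simp only [Subgroup.coe_mul, Equiv.Perm.mul_apply, this]
    simp

theorem levelStabilizer_antitone (m : ℕ) : Antitone (levelStabilizer m) := by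
  refine antitone_nat_of_succ_le fun n g hg u hu => ?_
  rcases Nat.eq_zero_or_pos m with rfl | hm
  · cases u with
    | nil => exact g.2.1
    | cons x _ => exact x.elim0
  · have hx := hg (u ++ [⟨0, hm⟩]) (by simp [hu])
    rcases (g.2.2 u (u ++ [⟨0, hm⟩])).2 (Or.inl ⟨_, rfl⟩) with ⟨y, hy⟩ | ⟨y, hy⟩
    · exact (List.append_inj' (hx.symm.trans hy) rfl).1.symm
    · have h1 := congrArg List.length hy
      simp only [length_apply, List.length_append, List.length_singleton] at h1
      omega

/-- The level stabilizers, as a basis of neighbourhoods of the identity. -/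
@[reducible]
def congruenceBasis (m : ℕ) : GroupFilterBasis (AutTree m) where
  sets := Set.range fun n => (levelStabilizer m n : Set (AutTree m))
  nonempty := Set.range_nonempty _
  inter_sets := by
    rintro _ _ ⟨i, rfl⟩ ⟨j, rfl⟩
    exact ⟨_, ⟨max i j, rfl⟩, fun g hg =>
      ⟨levelStabilizer_antitone m (le_max_left i j) hg,
        levelStabilizer_antitone m (le_max_right i j) hg⟩⟩
  one' := by
    rintro _ ⟨n, rfl⟩
    exact one_mem _
  mul' := by
    rintro _ ⟨n, rfl⟩
    refine ⟨_, ⟨n, rfl⟩, ?_⟩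
    rintro _ ⟨a, ha, b, hb, rfl⟩
    exact mul_mem ha hb
  inv' := by
    rintro _ ⟨n, rfl⟩
    exact ⟨_, ⟨n, rfl⟩, fun a ha => inv_mem ha⟩
  conj' := by
    rintro a _ ⟨n, rfl⟩
    exact ⟨_, ⟨n, rfl⟩, fun g hg => (levelStabilizer_normal m n).conj_mem g hg a⟩

/-- The congruence topology on `Aut T_m`. -/
instance congruenceTopology (m : ℕ) : TopologicalSpace (AutTree m) :=
  (congruenceBasis m).topology

instance isTopologicalGroup (m : ℕ) : IsTopologicalGroup (AutTree m) :=
  (congruenceBasis m).isTopologicalGroup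

end AutTree

/-- The permutation `σ` is the label of `g` at the vertex `v`: the action of `g` on the
immediate descendants of `v`. -/
def IsLabel {m : ℕ} (g : AutTree m) (v : List (Fin m)) (σ : Equiv.Perm (Fin m)) : Prop :=
  ∀ x, g.1 (v ++ [x]) = g.1 v ++ [σ x]

/-- The iterated permutational wreath product `W_H`: the automorphisms of the `m`-adic tree all of
whose labels belong to `H`. -/
def iteratedWreath {m : ℕ} (H : Subgroup (Equiv.Perm (Fin m))) : Subgroup (AutTree m) where
  carrier := {g | ∀ v, ∃ σ ∈ H, IsLabel g v σ}
  one_mem' := fun _ => ⟨1, one_mem H, fun _ => rfl⟩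
  mul_mem' := by
    intro g h hg hh v
    obtain ⟨τ, hτ, hτ'⟩ := hh v
    obtain ⟨σ, hσ, hσ'⟩ := hg (h.1 v)
    refine ⟨σ * τ, mul_mem hσ hτ, fun x => ?_⟩
    simp only [Subgroup.coe_mul, Equiv.Perm.mul_apply]
    rw [hτ' x, hσ' (τ x)]
  inv_mem' := by
    intro g hg v
    obtain ⟨σ, hσ, hσ'⟩ := hg ((g⁻¹ : AutTree m).1 v)
    refine ⟨σ⁻¹, inv_mem hσ, fun x => ?_⟩
    have := hσ' (σ⁻¹ x)
    simp only [InvMemClass.coe_inv] at this ⊢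
    rw [Equiv.Perm.inv_eq_iff_eq, this]
    simp

/-- The level-stabilizer filtration `n ↦ St_{W_H}(n) = St(n) ∩ W_H` of `W_H`. -/
def levelFiltration {m : ℕ} (H : Subgroup (Equiv.Perm (Fin m))) (n : ℕ) :
    Subgroup (iteratedWreath H) :=
  (AutTree.levelStabilizer m n).subgroupOf (iteratedWreath H)

/-- The Hausdorff dimension `liminf_n log |L G_n : G_n| / log |G : G_n|` of a closed subgroup `L` of
a profinite group `G` with respect to a filtration `(G_n)` by open normal subgroups (so all the
indices are finite and the quotients lie in `[0, 1]`). -/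
noncomputable def hausdorffDim {G : Type*} [Group G] (F : ℕ → Subgroup G) (L : Subgroup G) : ℝ :=
  Filter.liminf
    (fun n => Real.log ((F n).relIndex (L ⊔ F n)) / Real.log ((F n).index)) Filter.atTop

/-! ### Tree automorphisms with prescribed labels -/

/-! Let K be generated by the rooted copy of H and one directed element b. The index of St(n) in W_H
is at most |H|^(1 + m + … + m^(n-1)), and its index relative to K is the product over k < n of the
orders of the groups of level-k labels of K ∩ St(k) (`levelFiltration_relIndex`). So it suffices
that at level n this label group has order at least |H|^(m^n - m^n/(r+1)) with r = r(n) → ∞;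
averaging over levels then gives dimension 1 (`hausdorffDim_levelFiltration_eq_one`).

Such a bound comes from elements of K ∩ St(n) with at most two nontrivial labels at level n: h⁻¹ at
one vertex and a conjugate of h at another, for every h in H. If each vertex is paired in this way
at r different branching levels, the vertices fall into classes of more than r elements, and labels
can be prescribed freely outside one representative per class (`pow_le_card_of_linked`).

The pairs are commutators of powers of b. Cauchy's theorem in H yields roots, on a subtree, of
elements of exponent |H| (`exists_root`); planting them along the ray ooo… makes b^(|H|^(i+1))
trivial off the subtree at depth J i, where it reveals the i-th comb of prescribed labels
(`exists_directed`). A tooth of comb i moving o to x₁ at the branching level, commuted with a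
conjugate of a tooth of comb i+1 carrying h at level n, leaves exactly such a pair
(`commutator_mem`). K carries the vertices of the ray to all vertices with trivial section, so the
pairs can be put anywhere (`exists_linked`). J grows quadratically while the roots cost only linear
depth, so about √n branching levels are available at level n. -/

section Portrait

variable {m : ℕ}

/-- The action on words of the tree automorphism with label `p v` at the vertex `v`. -/
def portraitAct : (List (Fin m) → Equiv.Perm (Fin m)) → List (Fin m) → List (Fin m)
  | _, [] => []
  | p, x :: s => p [] x :: portraitAct (fun u => p (x :: u)) s

/-- The inverse of `portraitAct p`. -/
def portraitInv : (List (Fin m) → Equiv.Perm (Fin m)) → List (Fin m) → List (Fin m)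
  | _, [] => []
  | p, x :: s => (p [])⁻¹ x :: portraitInv (fun u => p ((p [])⁻¹ x :: u)) s

theorem portraitInv_portraitAct (p : List (Fin m) → Equiv.Perm (Fin m)) (s : List (Fin m)) :
    portraitInv p (portraitAct p s) = s := by
  induction s generalizing p with
  | nil => rfl
  | cons x s ih => simp [portraitAct, portraitInv, ih]

theorem portraitAct_portraitInv (p : List (Fin m) → Equiv.Perm (Fin m)) (s : List (Fin m)) :
    portraitAct p (portraitInv p s) = s := by
  induction s generalizing p with
  | nil => rfl
  | cons x s ih => simp [portraitAct, portraitInv, ih]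

theorem portraitAct_concat (p : List (Fin m) → Equiv.Perm (Fin m)) (v : List (Fin m))
    (x : Fin m) : portraitAct p (v ++ [x]) = portraitAct p v ++ [p v x] := by
  induction v generalizing p with
  | nil => rfl
  | cons y v ih => simp [portraitAct, ih]

/-- `portraitAct p` as a permutation of the set of vertices. -/
def portraitPerm (p : List (Fin m) → Equiv.Perm (Fin m)) : Equiv.Perm (List (Fin m)) where
  toFun := portraitAct p
  invFun := portraitInv p
  left_inv := portraitInv_portraitAct p
  right_inv := portraitAct_portraitInv p

theorem portraitPerm_concat (p : List (Fin m) → Equiv.Perm (Fin m)) (v : List (Fin m))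
    (x : Fin m) : portraitPerm p (v ++ [x]) = portraitPerm p v ++ [p v x] :=
  portraitAct_concat p v x

theorem portraitPerm_child_iff (p : List (Fin m) → Equiv.Perm (Fin m)) (u v : List (Fin m)) :
    (∃ x, portraitPerm p v = portraitPerm p u ++ [x]) ↔ ∃ x, v = u ++ [x] := by
  constructor
  · rintro ⟨x, hx⟩
    refine ⟨(p u)⁻¹ x, (portraitPerm p).injective ?_⟩
    rw [hx, portraitPerm_concat]
    simp
  · rintro ⟨x, rfl⟩
    exact ⟨_, portraitPerm_concat p u x⟩

/-- The element of `W_H` with label `p v` at the vertex `v`. -/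
def ofPortrait {H : Subgroup (Equiv.Perm (Fin m))} (p : List (Fin m) → H) : iteratedWreath H :=
  ⟨⟨portraitPerm fun v => (p v : Equiv.Perm (Fin m)), rfl, fun u v =>
    or_congr (portraitPerm_child_iff _ u v) (portraitPerm_child_iff _ v u)⟩,
    fun v => ⟨p v, (p v).2, fun x => portraitPerm_concat _ v x⟩⟩

variable {H : Subgroup (Equiv.Perm (Fin m))}

namespace iteratedWreath

theorem ofPortrait_smul_concat (p : List (Fin m) → H) (v : List (Fin m)) (x : Fin m) :
    ofPortrait p • (v ++ [x]) = ofPortrait p • v ++ [(p v : Equiv.Perm (Fin m)) x] :=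
  portraitPerm_concat _ v x

theorem ofPortrait_smul_cons (p : List (Fin m) → H) (x : Fin m) (s : List (Fin m)) :
    ofPortrait p • (x :: s) =
      (p [] : Equiv.Perm (Fin m)) x :: ofPortrait (fun u => p (x :: u)) • s :=
  rfl

theorem ext_smul {g h : iteratedWreath H} (hgh : ∀ v : List (Fin m), g • v = h • v) : g = h :=
  Subtype.ext (Subtype.ext (Equiv.ext hgh))

@[simp]
theorem length_smul (g : iteratedWreath H) (v : List (Fin m)) : (g • v).length = v.length :=
  AutTree.length_apply g.1 v

@[simp]
theorem smul_nil (g : iteratedWreath H) : g • ([] : List (Fin m)) = [] :=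
  g.1.2.1

/-- The label of `g` at `v`. -/
noncomputable def label (g : iteratedWreath H) (v : List (Fin m)) : H :=
  ⟨(g.2 v).choose, (g.2 v).choose_spec.1⟩

theorem smul_concat (g : iteratedWreath H) (v : List (Fin m)) (x : Fin m) :
    g • (v ++ [x]) = g • v ++ [(label g v : Equiv.Perm (Fin m)) x] :=
  (g.2 v).choose_spec.2 x

theorem label_eq {g : iteratedWreath H} {v : List (Fin m)} {σ : H}
    (h : ∀ x, g • (v ++ [x]) = g • v ++ [(σ : Equiv.Perm (Fin m)) x]) : label g v = σ := by
  refine Subtype.ext (Equiv.ext fun x => ?_)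
  have := (smul_concat g v x).symm.trans (h x)
  simpa using this

@[simp]
theorem label_ofPortrait (p : List (Fin m) → H) (v : List (Fin m)) :
    label (ofPortrait p) v = p v :=
  label_eq (ofPortrait_smul_concat p v)

/-- The section of `g` at `v`: the action of `g` from the subtree at `v` to the one at `g • v`. -/
noncomputable def sec (g : iteratedWreath H) (v : List (Fin m)) : iteratedWreath H :=
  ofPortrait fun u => label g (v ++ u)

theorem smul_append (g : iteratedWreath H) (v s : List (Fin m)) :
    g • (v ++ s) = g • v ++ sec g v • s := by
  induction s using List.reverseRecOn with
  | nil => simp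
  | append_singleton s x ih =>
    rw [← List.append_assoc, smul_concat, ih, smul_concat (sec g v), List.append_assoc]
    simp [sec]

theorem sec_eq {g k : iteratedWreath H} {v : List (Fin m)}
    (h : ∀ s : List (Fin m), g • (v ++ s) = g • v ++ k • s) : sec g v = k :=
  ext_smul fun s => List.append_cancel_left ((smul_append g v s).symm.trans (h s))

@[simp]
theorem sec_nil (g : iteratedWreath H) : sec g [] = g :=
  sec_eq fun s => by simp

theorem sec_append (g : iteratedWreath H) (v w : List (Fin m)) :
    sec g (v ++ w) = sec (sec g v) w :=
  sec_eq fun s => by rw [List.append_assoc, smul_append, smul_append, smul_append g v w,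
    List.append_assoc]

theorem sec_mul (g h : iteratedWreath H) (v : List (Fin m)) :
    sec (g * h) v = sec g (h • v) * sec h v :=
  sec_eq fun s => by rw [mul_smul, mul_smul, mul_smul, smul_append, smul_append]

@[simp]
theorem sec_one (v : List (Fin m)) : sec (1 : iteratedWreath H) v = 1 :=
  sec_eq fun s => by simp

theorem sec_inv (g : iteratedWreath H) (v : List (Fin m)) :
    sec g⁻¹ v = (sec g (g⁻¹ • v))⁻¹ := by
  rw [eq_inv_iff_mul_eq_one, ← sec_one (H := H) (g⁻¹ • v)]
  conv_rhs => rw [← inv_mul_cancel g, sec_mul, smul_inv_smul]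

theorem sec_pow_of_smul_eq {g : iteratedWreath H} {v : List (Fin m)} (h : g • v = v) (n : ℕ) :
    sec (g ^ n) v = sec g v ^ n := by
  induction n with
  | zero => simp
  | succ n ih => rw [pow_succ, sec_mul, h, ih, pow_succ]

theorem pow_smul_of_smul_eq {g : iteratedWreath H} {v : List (Fin m)} (h : g • v = v) (n : ℕ) :
    g ^ n • v = v := by
  induction n with
  | zero => simp
  | succ n ih => rw [pow_succ, mul_smul, h, ih]

theorem smul_take (g : iteratedWreath H) (n : ℕ) (v : List (Fin m)) :
    g • v.take n = (g • v).take n := by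
  rcases le_total n v.length with h | h
  · conv_rhs => rw [← List.take_append_drop n v, smul_append]
    rw [List.take_left' (by simp [h])]
  · rw [List.take_of_length_le h, List.take_of_length_le (by simpa using h)]

/-- A tree automorphism preserves the prefix relation. -/
theorem smul_prefix_smul_iff (g : iteratedWreath H) {v s : List (Fin m)} :
    g • v <+: g • s ↔ v <+: s := by
  have key : ∀ (k : iteratedWreath H) (v s : List (Fin m)), v <+: s → k • v <+: k • s := by
    rintro k v _ ⟨t, rfl⟩
    exact ⟨_, (smul_append k v t).symm⟩
  refine ⟨fun h => ?_, key g v s⟩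
  simpa using key g⁻¹ _ _ h

/-! ### Elements given by their decomposition at the root -/

/-- The element with label `σ` at the root and sections `f x` at the first level. -/
noncomputable def node (σ : H) (f : Fin m → iteratedWreath H) : iteratedWreath H :=
  ofPortrait fun
    | [] => σ
    | x :: u => label (f x) u

@[simp]
theorem ofPortrait_label (g : iteratedWreath H) : ofPortrait (label g) = g := by
  simpa [sec] using sec_nil g

@[simp]
theorem node_smul_cons (σ : H) (f : Fin m → iteratedWreath H) (x : Fin m) (s : List (Fin m)) :
    node σ f • (x :: s) = (σ : Equiv.Perm (Fin m)) x :: f x • s := by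
  conv_rhs => rw [← ofPortrait_label (f x)]
  exact ofPortrait_smul_cons _ x s

theorem ext_cons {g h : iteratedWreath H}
    (hgh : ∀ (x : Fin m) (s : List (Fin m)), g • (x :: s) = h • (x :: s)) : g = h :=
  ext_smul fun v => by
    cases v with
    | nil => simp
    | cons x s => exact hgh x s

@[simp]
theorem sec_node (σ : H) (f : Fin m → iteratedWreath H) (x : Fin m) :
    sec (node σ f) [x] = f x :=
  sec_eq fun s => by simp

theorem sec_node_cons (σ : H) (f : Fin m → iteratedWreath H) (x : Fin m) (v : List (Fin m)) :
    sec (node σ f) (x :: v) = sec (f x) v := by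
  rw [← List.singleton_append, sec_append, sec_node]

theorem node_mul (σ τ : H) (f k : Fin m → iteratedWreath H) :
    node σ f * node τ k =
      node (σ * τ) (fun x => f ((τ : Equiv.Perm (Fin m)) x) * k x) :=
  ext_cons fun x s => by simp [mul_smul]

theorem node_one_one : node (1 : H) (1 : Fin m → iteratedWreath H) = 1 :=
  ext_cons fun x s => by simp

theorem node_one_pow (f : Fin m → iteratedWreath H) (n : ℕ) :
    node 1 f ^ n = node 1 (fun x => f x ^ n) := by
  induction n with
  | zero => simpa using! node_one_one.symm
  | succ n ih => simp [pow_succ, ih, node_mul]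

/-- The rooted element with label `h`. -/
noncomputable def rooted : H →* iteratedWreath H where
  toFun h := node h 1
  map_one' := node_one_one
  map_mul' g h := by rw [node_mul]; simp; rfl

@[simp]
theorem rooted_smul_cons (h : H) (x : Fin m) (s : List (Fin m)) :
    rooted h • (x :: s) = (h : Equiv.Perm (Fin m)) x :: s := by
  simp [rooted]

theorem sec_rooted (h : H) (x : Fin m) (s : List (Fin m)) : sec (rooted h) (x :: s) = 1 := by
  simp [rooted, sec_node_cons]

/-! ### Elements supported on one subtree -/

/-- The element acting as `g` on the subtree at `v` and trivially elsewhere. -/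
noncomputable def atVertex : List (Fin m) → iteratedWreath H →* iteratedWreath H
  | [] => MonoidHom.id _
  | x :: v =>
    { toFun g := node 1 (Pi.mulSingle x (atVertex v g))
      map_one' := by simpa using node_one_one
      map_mul' g h := by
        rw [node_mul, map_mul, Pi.mulSingle_mul]; simp; rfl }

theorem atVertex_cons (x : Fin m) (v : List (Fin m)) (g : iteratedWreath H) :
    atVertex (x :: v) g = node 1 (Pi.mulSingle x (atVertex v g)) :=
  rfl

@[simp]
theorem atVertex_smul_append (v s : List (Fin m)) (g : iteratedWreath H) :
    atVertex v g • (v ++ s) = v ++ g • s := by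
  induction v with
  | nil => rfl
  | cons x v ih => simp [atVertex_cons, ih]

@[simp]
theorem atVertex_smul_self (v : List (Fin m)) (g : iteratedWreath H) : atVertex v g • v = v := by
  simpa using atVertex_smul_append v [] g

theorem atVertex_smul_of_not_prefix {v s : List (Fin m)} (h : ¬ v <+: s)
    (g : iteratedWreath H) : atVertex v g • s = s := by
  induction v generalizing s with
  | nil => simp at h
  | cons x v ih =>
    cases s with
    | nil => simp
    | cons y s =>
      rw [atVertex_cons, node_smul_cons]
      rcases eq_or_ne y x with rfl | hne
      · simp at h
        simp [ih h]
      · simp [Pi.mulSingle_eq_of_ne hne]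

@[simp]
theorem sec_atVertex_self (v : List (Fin m)) (g : iteratedWreath H) : sec (atVertex v g) v = g :=
  sec_eq fun s => by simp

theorem atVertex_append (v w : List (Fin m)) (g : iteratedWreath H) :
    atVertex (v ++ w) g = atVertex v (atVertex w g) := by
  induction v with
  | nil => rfl
  | cons x v ih => simp [atVertex_cons, ih]

theorem sec_atVertex_append (v w : List (Fin m)) (g : iteratedWreath H) :
    sec (atVertex (v ++ w) g) v = atVertex w g := by
  rw [atVertex_append, sec_atVertex_self]

/-- Conjugation transports the support and twists by the section of `k`; when that section is
trivial, `g` is copied unchanged. This is why trivial sections are tracked in the transitivity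
statements. -/
theorem mul_atVertex (k : iteratedWreath H) (v : List (Fin m)) (g : iteratedWreath H) :
    k * atVertex v g * k⁻¹ = atVertex (k • v) (sec k v * g * (sec k v)⁻¹) := by
  rw [mul_inv_eq_iff_eq_mul]
  refine ext_smul fun s => ?_
  by_cases h : v <+: s
  · obtain ⟨s, rfl⟩ := h
    rw [mul_smul, mul_smul, atVertex_smul_append, smul_append, smul_append k,
      atVertex_smul_append, mul_smul, mul_smul, inv_smul_smul]
  · rw [mul_smul, mul_smul, atVertex_smul_of_not_prefix h,
      atVertex_smul_of_not_prefix (by rwa [smul_prefix_smul_iff])]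

/-- Only the part of `k` below `v` meets the support of `atVertex v g`, so the commutator localises
to the subtree. -/
theorem commutator_atVertex {k : iteratedWreath H} {v : List (Fin m)} (h : k • v = v)
    (g : iteratedWreath H) : k * atVertex v g * k⁻¹ * (atVertex v g)⁻¹ =
      atVertex v (sec k v * g * (sec k v)⁻¹ * g⁻¹) := by
  rw [mul_atVertex, h, ← map_inv, ← map_mul]

theorem atVertex_commutator {k : iteratedWreath H} {v : List (Fin m)} (h : k • v = v)
    (g : iteratedWreath H) : atVertex v g * k * (atVertex v g)⁻¹ * k⁻¹ =
      atVertex v (g * sec k v * g⁻¹ * (sec k v)⁻¹) := by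
  have := mul_atVertex k v g⁻¹
  rw [h, map_inv] at this
  calc _ = atVertex v g * (k * (atVertex v g)⁻¹ * k⁻¹) := by group
    _ = _ := by rw [this, ← map_mul]; simp only [mul_assoc]

end iteratedWreath

end Portrait

namespace iteratedWreath

section Spine

variable {m : ℕ} {H : Subgroup (Equiv.Perm (Fin m))}

/-! ### Roots of prescribed elements on a subtree -/

theorem node_pow_smul_singleton (h : H) (f : Fin m → iteratedWreath H) (n : ℕ) (x : Fin m) :
    node h f ^ n • [x] = [((h ^ n : H) : Equiv.Perm (Fin m)) x] := by
  induction n with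
  | zero => simp
  | succ n ih => rw [pow_succ', mul_smul, ih]; simp [pow_succ']

theorem exists_sec_node_mulSingle_pow (h : H) (x z : Fin m) (f : iteratedWreath H) (n : ℕ) :
    ∃ c : ℕ, sec (node h (Pi.mulSingle x f) ^ n) [z] = f ^ c := by
  induction n with
  | zero => exact ⟨0, by simp⟩
  | succ n ih =>
    obtain ⟨c, hc⟩ := ih
    rw [pow_succ', sec_mul, hc, node_pow_smul_singleton, sec_node]
    by_cases hz : ((h ^ n : H) : Equiv.Perm (Fin m)) z = x
    · exact ⟨c + 1, by rw [hz, Pi.mulSingle_eq_same, pow_succ']⟩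
    · exact ⟨c, by rw [Pi.mulSingle_eq_of_ne hz, one_mul]⟩

/-- The orbit of `x` picks up the factor `f` only at its starting point, as it does not return to
`x` in the meantime. -/
theorem sec_node_mulSingle_pow_self (h : H) (x : Fin m) (f : iteratedWreath H) (n : ℕ)
    (hn : ∀ i, 0 < i → i ≤ n → ((h ^ i : H) : Equiv.Perm (Fin m)) x ≠ x) :
    sec (node h (Pi.mulSingle x f) ^ (n + 1)) [x] = f := by
  induction n with
  | zero => simp
  | succ n ih =>
    rw [pow_succ', sec_mul, ih fun i h0 hi => hn i h0 (hi.trans n.le_succ),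
      node_pow_smul_singleton, sec_node, Pi.mulSingle_eq_of_ne (hn _ n.succ_pos le_rfl), one_mul]

theorem node_mulSingle_pow_eq_one {h : H} {x : Fin m} {f : iteratedWreath H} {p M : ℕ}
    (hp : h ^ p = 1) (hf : f ^ M = 1) : node h (Pi.mulSingle x f) ^ (p * M) = 1 := by
  refine ext_cons fun z s => ?_
  obtain ⟨c, hc⟩ := exists_sec_node_mulSingle_pow h x z f p
  have hz : node h (Pi.mulSingle x f) ^ p • [z] = [z] := by
    simp [node_pow_smul_singleton, hp]
  rw [pow_mul, ← List.singleton_append, smul_append, pow_smul_of_smul_eq hz,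
    sec_pow_of_smul_eq hz, hc, ← pow_mul, mul_comm, pow_mul, hf]
  simp

/-- The period of `x` divides `p` and is not 1, hence is `p`. -/
theorem pow_apply_ne_of_prime {h : H} {x : Fin m} {p : ℕ} (hp : p.Prime) (hh : h ^ p = 1)
    (hx : (h : Equiv.Perm (Fin m)) x ≠ x) {i : ℕ} (h0 : 0 < i) (hi : i < p) :
    ((h ^ i : H) : Equiv.Perm (Fin m)) x ≠ x := by
  intro h1
  have hper : ∀ n : ℕ, ((h ^ n : H) : Equiv.Perm (Fin m)) x = x →
      Function.IsPeriodicPt (h : Equiv.Perm (Fin m)) n x := by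
    intro n hn
    rwa [Function.IsPeriodicPt, Function.IsFixedPt, Equiv.Perm.iterate_eq_pow,
      ← Subgroup.coe_pow]
  have h2 := (hper i h1).gcd (hper p (by simp [hh]))
  rw [((Nat.coprime_of_lt_prime (by omega) hi hp).symm : Nat.gcd i p = 1)] at h2
  exact hx h2

/-- Extracts one more prime root: the `p`-th power of the new element fixes `x` and has section `e`
there. Control of the order is carried along so that high powers can later be made to vanish. -/
theorem node_mulSingle_root {h : H} {x : Fin m} {e φ : iteratedWreath H} {π : List (Fin m)}
    {p A M : ℕ} (hp : p.Prime) (hh : h ^ p = 1) (hx : (h : Equiv.Perm (Fin m)) x ≠ x)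
    (he : e ^ A • π = π) (hφ : sec (e ^ A) π = φ) (hM : e ^ (A * M) = 1) :
    node h (Pi.mulSingle x e) ^ (p * A) • (x :: π) = x :: π ∧
      sec (node h (Pi.mulSingle x e) ^ (p * A)) (x :: π) = φ ∧
      node h (Pi.mulSingle x e) ^ (p * A * M) = 1 := by
  obtain ⟨n, rfl⟩ : ∃ n, p = n + 1 := ⟨p - 1, (Nat.succ_pred_prime hp).symm⟩
  have hs := sec_node_mulSingle_pow_self h x e n fun i h0 hi =>
    pow_apply_ne_of_prime hp hh hx h0 (Nat.lt_succ_of_le hi)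
  have hf : node h (Pi.mulSingle x e) ^ (n + 1) • [x] = [x] := by
    simp [node_pow_smul_singleton, hh]
  refine ⟨?_, ?_, ?_⟩
  · rw [← List.singleton_append, smul_append, pow_mul, pow_smul_of_smul_eq hf,
      sec_pow_of_smul_eq hf, hs, he]
  · rw [← List.singleton_append, sec_append, pow_mul, sec_pow_of_smul_eq hf, hs, hφ]
  · rw [mul_assoc]
    exact node_mulSingle_pow_eq_one hh hM

theorem exists_pow_eq_one_and_apply_ne {p : ℕ} (hp : p.Prime) (hd : p ∣ Nat.card H) :
    ∃ (h : H) (x : Fin m), h ^ p = 1 ∧ (h : Equiv.Perm (Fin m)) x ≠ x := by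
  have := Fact.mk hp
  obtain ⟨h, hh⟩ := exists_prime_orderOf_dvd_card' p hd
  have h1 : h ≠ 1 := by
    rintro rfl
    exact hp.one_lt.ne (by simpa using hh)
  obtain ⟨x, hx⟩ : ∃ x, (h : Equiv.Perm (Fin m)) x ≠ x := by
    by_contra! hc
    exact h1 (Subtype.ext (Equiv.ext hc))
  exact ⟨h, x, hh ▸ pow_orderOf_eq_one h, hx⟩

/-- On some subtree, every `φ` is a prescribed power of an element of `W_H`, as long as all prime
factors of the exponent divide `|H|`. -/
theorem exists_root {φ : iteratedWreath H} {M : ℕ} (hφ : φ ^ M = 1) (L : List ℕ)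
    (hL : ∀ p ∈ L, p.Prime ∧ p ∣ Nat.card H) :
    ∃ (e : iteratedWreath H) (π : List (Fin m)), π.length = L.length ∧ e ^ L.prod • π = π ∧
      sec (e ^ L.prod) π = φ ∧ e ^ (L.prod * M) = 1 := by
  induction L with
  | nil => exact ⟨φ, [], by simp [hφ]⟩
  | cons p L ih =>
    obtain ⟨e, π, h1, h2, h3, h4⟩ := ih fun q hq => hL q (List.mem_cons_of_mem _ hq)
    obtain ⟨hp, hd⟩ := hL p List.mem_cons_self
    obtain ⟨h, x, hh, hx⟩ := exists_pow_eq_one_and_apply_ne hp hd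
    have := node_mulSingle_root hp hh hx h2 h3 h4
    exact ⟨node h (Pi.mulSingle x e), x :: π, by simp [h1], by simpa using this⟩

/-! ### Directed elements -/

/-- The labels of `spine o F j`. -/
noncomputable def spinePortrait (o : Fin m) (F : ℕ → Fin m → iteratedWreath H) :
    ℕ → List (Fin m) → H
  | _, [] => 1
  | j, x :: s => if x = o then spinePortrait o F (j + 1) s else label (F j x) s

/-- The element directed along the ray `o o o …`, whose section at `oⁿ x` is `F (j + n) x` for each
letter `x ≠ o`. -/
noncomputable def spine (o : Fin m) (F : ℕ → Fin m → iteratedWreath H) (j : ℕ) :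
    iteratedWreath H :=
  ofPortrait (spinePortrait o F j)

theorem spine_eq (o : Fin m) (F : ℕ → Fin m → iteratedWreath H) (j : ℕ) :
    spine o F j = node 1 (fun x => if x = o then spine o F (j + 1) else F j x) := by
  refine ext_cons fun x s => ?_
  rw [node_smul_cons, spine, ofPortrait_smul_cons]
  by_cases hx : x = o
  · simp [hx, spinePortrait, spine]
  · simp [hx, spinePortrait]

theorem spine_smul_singleton (o : Fin m) (F : ℕ → Fin m → iteratedWreath H) (j : ℕ)
    (x : Fin m) : spine o F j • [x] = [x] := by
  rw [spine_eq]; simp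

theorem sec_spine_self (o : Fin m) (F : ℕ → Fin m → iteratedWreath H) (j : ℕ) :
    sec (spine o F j) [o] = spine o F (j + 1) := by
  rw [spine_eq]; simp

theorem sec_spine_of_ne {o x : Fin m} (hx : x ≠ o) (F : ℕ → Fin m → iteratedWreath H) (j : ℕ) :
    sec (spine o F j) [x] = F j x := by
  rw [spine_eq]; simp [hx]

/-- The labels along the ray are trivial, so powers are taken separately in each branch. -/
theorem spine_pow (o : Fin m) (F : ℕ → Fin m → iteratedWreath H) (j N : ℕ) :
    spine o F j ^ N = spine o (fun i x => F i x ^ N) j := by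
  refine ext_smul fun v => ?_
  induction v generalizing j with
  | nil => simp
  | cons x s ih =>
    rw [spine_eq, node_one_pow, spine_eq o (fun i x => F i x ^ N)]
    by_cases hx : x = o
    · simp [hx, ih]
    · simp [hx]

theorem spine_one (o : Fin m) (j : ℕ) : spine o (1 : ℕ → Fin m → iteratedWreath H) j = 1 := by
  have := spine_pow o (1 : ℕ → Fin m → iteratedWreath H) j 0
  simpa using! this.symm

theorem spine_smul_replicate (o : Fin m) (F : ℕ → Fin m → iteratedWreath H) (j n : ℕ) :
    spine o F j • List.replicate n o = List.replicate n o ∧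
      sec (spine o F j) (List.replicate n o) = spine o F (j + n) := by
  induction n generalizing j with
  | zero => simp
  | succ n ih =>
    rw [List.replicate_succ, ← List.singleton_append, smul_append, sec_append, sec_spine_self,
      spine_smul_singleton, (ih _).1, (ih _).2, Nat.add_right_comm]
    exact ⟨rfl, rfl⟩

theorem spine_smul_replicate_append {o x : Fin m} (hx : x ≠ o)
    (F : ℕ → Fin m → iteratedWreath H) (j n : ℕ) :
    spine o F j • (List.replicate n o ++ [x]) = List.replicate n o ++ [x] ∧
      sec (spine o F j) (List.replicate n o ++ [x]) = F (j + n) x := by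
  rw [smul_append, sec_append, (spine_smul_replicate o F j n).1,
    (spine_smul_replicate o F j n).2, spine_smul_singleton, sec_spine_of_ne hx]
  exact ⟨rfl, rfl⟩

/-- Used for powers of a directed element that kill the first `n` branches. -/
theorem spine_eq_atVertex (o : Fin m) {F : ℕ → Fin m → iteratedWreath H} (j n : ℕ)
    (hF : ∀ i < n, ∀ x ≠ o, F (j + i) x = 1) :
    spine o F j = atVertex (List.replicate n o) (spine o F (j + n)) := by
  induction n generalizing j with
  | zero => rfl
  | succ n ih =>
    rw [List.replicate_succ, atVertex_cons, spine_eq, ih (j + 1), Nat.add_right_comm]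
    · congr 1
      funext x
      by_cases hx : x = o
      · subst hx; simp; rfl
      · simpa [hx] using hF 0 n.succ_pos x hx
    · intro i hi x hx
      rw [add_assoc, add_comm 1 i]
      exact hF (i + 1) (by omega) x hx

/-! ### Transitivity -/

/-- The sections at `v` of the elements of `S` that fix `v`. -/
def sectionGroup (S : Subgroup (iteratedWreath H)) (v : List (Fin m)) :
    Subgroup (iteratedWreath H) where
  carrier := {g | ∃ k ∈ S, k • v = v ∧ sec k v = g}
  one_mem' := ⟨1, one_mem S, by simp⟩
  mul_mem' := by
    rintro _ _ ⟨k, hk, hkv, rfl⟩ ⟨l, hl, hlv, rfl⟩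
    exact ⟨k * l, mul_mem hk hl, by rw [mul_smul, hlv, hkv], by rw [sec_mul, hlv]⟩
  inv_mem' := by
    rintro _ ⟨k, hk, hkv, rfl⟩
    have hv : k⁻¹ • v = v := by rw [inv_smul_eq_iff, hkv]
    exact ⟨k⁻¹, inv_mem hk, hv, by rw [sec_inv, hv]⟩

/-- A group containing a directed element acts transitively on the levels, through elements with
trivial section at a vertex of the ray, if the sections `F j x` and some elements of the group
carry the letter `o` to all letters. -/
theorem exists_smul_replicate_eq {o : Fin m} {F : ℕ → Fin m → iteratedWreath H}
    (hF : ∀ j, ∀ x ≠ o, F j x • [o] = [x] ∧ sec (F j x) [o] = 1) (n j : ℕ)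
    (S : Subgroup (iteratedWreath H)) (hb : spine o F j ∈ S)
    (hS : ∀ x, ∃ τ ∈ S, τ • [o] = [x] ∧ sec τ [o] = 1) (v : List (Fin m)) (hv : v.length = n) :
    ∃ c ∈ S, c • List.replicate n o = v ∧ sec c (List.replicate n o) = 1 := by
  induction n generalizing j S v with
  | zero =>
    obtain rfl := List.length_eq_zero_iff.1 hv
    exact ⟨1, one_mem S, by simp⟩
  | succ n ih =>
    cases v with
    | nil => simp at hv
    | cons x v =>
    -- Conjugating by `τ` brings every first-level section of the directed element to `o`. The
    -- section group at `o` thus contains the next directed element and the `F j x` with `x ≠ o`,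
    -- which are what the induction needs.
    have hmem : ∀ x, sec (spine o F j) [x] ∈ sectionGroup S [o] := by
      intro x
      obtain ⟨τ, hτ, h1, h2⟩ := hS x
      have h3 : τ⁻¹ • [x] = [o] := by rw [inv_smul_eq_iff, h1]
      refine ⟨τ⁻¹ * spine o F j * τ, mul_mem (mul_mem (inv_mem hτ) hb) hτ, ?_, ?_⟩
      · rw [mul_smul, mul_smul, h1, spine_smul_singleton, h3]
      · rw [sec_mul, sec_mul, h1, h2, spine_smul_singleton, sec_inv, h3, h2]
        simp
    obtain ⟨c', ⟨k, hk, hk1, rfl⟩, h1, h2⟩ := ih (j + 1) (sectionGroup S [o])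
      (sec_spine_self o F j ▸ hmem o) (fun x => by
        by_cases hx : x = o
        · subst hx
          exact ⟨1, one_mem _, by simp⟩
        · exact ⟨F j x, sec_spine_of_ne hx F j ▸ hmem x, hF j x hx⟩) v (by simpa using hv)
    obtain ⟨τ, hτ, h3, h4⟩ := hS x
    refine ⟨τ * k, mul_mem hτ hk, ?_, ?_⟩
    · rw [mul_smul, List.replicate_succ, ← List.singleton_append, smul_append, smul_append, hk1,
        h3, h4, h1]
      simp
    · rw [sec_mul, List.replicate_succ, ← List.singleton_append, sec_append k, h2,
        smul_append, hk1, h1, sec_append, h4]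
      simp

theorem exists_smul_eq_and_sec_eq_one {S : Subgroup (iteratedWreath H)} {o : Fin m}
    (hS : ∀ v : List (Fin m), ∃ c ∈ S, c • List.replicate v.length o = v ∧
      sec c (List.replicate v.length o) = 1) {u v : List (Fin m)} (h : u.length = v.length) :
    ∃ c ∈ S, c • u = v ∧ sec c u = 1 := by
  obtain ⟨c, hc, h1, h2⟩ := hS u
  obtain ⟨d, hd, h3, h4⟩ := hS v
  have h5 : c⁻¹ • u = List.replicate v.length o := by rw [inv_smul_eq_iff, ← h, h1]
  refine ⟨d * c⁻¹, mul_mem hd (inv_mem hc), ?_, ?_⟩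
  · rw [mul_smul, h5, h3]
  · rw [sec_mul, h5, h4, sec_inv, h5, ← h, h2]
    simp

end Spine

end iteratedWreath

section Counting

/-! ### Counting label functions -/

/-- `u` and `u'` are linked in `I` if the values at `u` of the elements of `I` that are trivial
outside `{u, u'}` are arbitrary. -/
def Linked {V G : Type*} [Group G] (I : Subgroup (V → G)) (u u' : V) : Prop :=
  ∀ h : G, ∃ f ∈ I, f u = h ∧ ∀ p, p ≠ u → p ≠ u' → f p = 1

variable {V G : Type*} [Group G]

/-- The unwanted value at `u'` is cancelled by an element linking `u'` to `u''`, which is trivial at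
`u`. -/
theorem Linked.trans {I : Subgroup (V → G)} {u u' u'' : V} (h : Linked I u u')
    (h' : Linked I u' u'') (h1 : u ≠ u') (h2 : u ≠ u'') : Linked I u u'' := by
  intro g
  obtain ⟨f, hf, hfu, hf'⟩ := h g
  obtain ⟨k, hk, hku, hk'⟩ := h' (f u')⁻¹
  refine ⟨f * k, mul_mem hf hk, ?_, fun p hp hp' => ?_⟩
  · rw [Pi.mul_apply, hfu, hk' u h1 h2, mul_one]
  · by_cases hpu : p = u'
    · rw [Pi.mul_apply, hpu, hku, mul_inv_cancel]
    · rw [Pi.mul_apply, hf' p hp hpu, hk' p hpu hp', mul_one]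

/-- Being equal or linked both ways is an equivalence relation. -/
def linkedSetoid (I : Subgroup (V → G)) : Setoid V where
  r u u' := u = u' ∨ Linked I u u' ∧ Linked I u' u
  iseqv :=
    { refl := fun _ => Or.inl rfl
      symm := fun h => h.imp Eq.symm And.symm
      trans := by
        rintro u u' u'' (rfl | h) (rfl | h')
        · exact Or.inl rfl
        · exact Or.inr h'
        · exact Or.inr h
        · by_cases h1 : u = u'
          · exact Or.inr (h1 ▸ h')
          by_cases h2 : u = u''
          · exact Or.inl h2
          by_cases h3 : u' = u''
          · exact Or.inr (h3 ▸ h)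
          exact Or.inr ⟨h.1.trans h'.1 h1 h2, h'.2.trans h.2 (Ne.symm h3) (Ne.symm h2)⟩ }

/-- Values are corrected one index at a time; the side effect of each correction falls on an index
outside `P`, where nothing is prescribed. -/
theorem exists_mem_forall_eq {I : Subgroup (V → G)} {P : V → Prop}
    (hP : ∀ u, P u → ∃ u', ¬ P u' ∧ Linked I u u') (φ : V → G) (s : Finset V)
    (hs : ∀ u ∈ s, P u) : ∃ f ∈ I, (∀ u ∈ s, f u = φ u) ∧ ∀ u ∉ s, P u → f u = 1 := by
  classical
  induction s using Finset.induction_on with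
  | empty => exact ⟨1, one_mem I, by simp⟩
  | insert a s ha ih =>
    obtain ⟨f, hf, h1, h2⟩ := ih fun u hu => hs u (Finset.mem_insert_of_mem hu)
    have hPa := hs a (Finset.mem_insert_self a s)
    obtain ⟨a', hPa', hl⟩ := hP a hPa
    obtain ⟨k, hk, h3, h4⟩ := hl (φ a)
    have hne : ∀ u, P u → u ≠ a' := fun u hu h => hPa' (h ▸ hu)
    refine ⟨f * k, mul_mem hf hk, fun u hu => ?_, fun u hu hPu => ?_⟩
    · rcases Finset.mem_insert.1 hu with rfl | hu'
      · rw [Pi.mul_apply, h2 u ha hPa, h3, one_mul]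
      · rw [Pi.mul_apply, h1 u hu', h4 u (fun h => ha (h ▸ hu')) (hne u (hs u hu)), mul_one]
    · rw [Finset.mem_insert, not_or] at hu
      rw [Pi.mul_apply, h2 u hu.2 hPu, h4 u hu.1 (hne u hPu), mul_one]

/-- If every index is linked both ways with `r` others, then `I` is large. -/
theorem pow_le_card_of_linked [Finite V] [Finite G] {I : Subgroup (V → G)} {r : ℕ}
    (hr : ∀ u, ∃ ν : Fin r → V, Function.Injective ν ∧
      ∀ k, ν k ≠ u ∧ Linked I u (ν k) ∧ Linked I (ν k) u) :
    Nat.card G ^ (Nat.card V - Nat.card V / (r + 1)) ≤ Nat.card I := by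
  classical
  choose ν hν hν' using hr
  let s := linkedSetoid I
  let rep : V → V := fun u => (Quotient.mk s u).out
  have hrep : ∀ u, rep (rep u) = rep u := fun u => by simp [rep]
  -- Each class contains a representative and its `r` linked partners.
  have hcls : Nat.card (Quotient s) * (r + 1) ≤ Nat.card V := by
    have hmk : ∀ (q : Quotient s) (k : Option (Fin r)),
        Quotient.mk s (k.elim q.out (ν q.out)) = q := by
      intro q k
      cases k with
      | none => simp
      | some k =>
        conv_rhs => rw [← q.out_eq]
        exact Quotient.sound (Or.inr ⟨(hν' q.out k).2.2, (hν' q.out k).2.1⟩)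
    have hinj : Function.Injective
        (fun z : Quotient s × Option (Fin r) => z.2.elim z.1.out (ν z.1.out)) := by
      rintro ⟨q, k⟩ ⟨q', k'⟩ h
      have hq : q = q' := by
        rw [← hmk q k, ← hmk q' k']
        exact congrArg _ h
      subst hq
      cases k with
      | none =>
        cases k' with
        | none => rfl
        | some k' => exact absurd h.symm (hν' q.out k').1
      | some k =>
        cases k' with
        | none => exact absurd h (hν' q.out k).1
        | some k' => rw [hν q.out h]
    simpa [Nat.card_prod, Nat.card_eq_fintype_card (α := Option (Fin r))] using
      Nat.card_le_card_of_injective _ hinj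
  have hnon : Nat.card V - Nat.card V / (r + 1) ≤ Nat.card {u // rep u ≠ u} := by
    have h1 : Nat.card {u // rep u = u} ≤ Nat.card (Quotient s) := by
      refine Nat.card_le_card_of_injective (fun u => Quotient.mk s u.1) fun u v huv => ?_
      refine Subtype.ext ?_
      rw [← u.2, ← v.2]
      exact congrArg Quotient.out huv
    have h2 : Nat.card V = Nat.card {u // rep u = u} + Nat.card {u // rep u ≠ u} := by
      rw [← Nat.card_sum]
      exact Nat.card_congr (Equiv.sumCompl _).symm
    have h3 : Nat.card (Quotient s) ≤ Nat.card V / (r + 1) :=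
      (Nat.le_div_iff_mul_le r.succ_pos).2 hcls
    omega
  have hlink : ∀ u, rep u ≠ u → ∃ u', ¬ rep u' ≠ u' ∧ Linked I u u' := by
    intro u hu
    refine ⟨rep u, by simpa using hrep u, ?_⟩
    rcases Quotient.mk_out (s := s) u with h | h
    · exact absurd h hu
    · exact h.2
  have hext : ∀ φ : {u // rep u ≠ u} → G, ∃ f : I, ∀ u, f.1 u.1 = φ u := by
    intro φ
    have := Fintype.ofFinite V
    obtain ⟨f, hf, h1, -⟩ := exists_mem_forall_eq hlink
      (fun u => if h : rep u ≠ u then φ ⟨u, h⟩ else 1) (Finset.univ.filter fun u => rep u ≠ u)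
      (by simp)
    exact ⟨⟨f, hf⟩, fun u => by simpa [u.2] using h1 u.1 (by simpa using u.2)⟩
  choose ext hext using hext
  calc Nat.card G ^ (Nat.card V - Nat.card V / (r + 1))
      ≤ Nat.card G ^ Nat.card {u // rep u ≠ u} := Nat.pow_le_pow_right Nat.card_pos hnon
    _ = Nat.card ({u // rep u ≠ u} → G) := Nat.card_fun.symm
    _ ≤ Nat.card I := Nat.card_le_card_of_injective ext fun φ ψ h =>
      funext fun u => by rw [← hext φ, ← hext ψ, h]

end Counting

namespace iteratedWreath

/-! ### Indices of level stabilizers through label groups -/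

section Levels

variable {m : ℕ} {H : Subgroup (Equiv.Perm (Fin m))}

theorem mem_levelFiltration {g : iteratedWreath H} {n : ℕ} :
    g ∈ levelFiltration H n ↔ ∀ v : List (Fin m), v.length = n → g • v = v :=
  Iff.rfl

theorem levelFiltration_antitone : Antitone (levelFiltration H) := fun _ _ h _ hg =>
  AutTree.levelStabilizer_antitone m h hg

theorem levelFiltration_zero : levelFiltration H 0 = ⊤ :=
  eq_top_iff.2 fun g _ => mem_levelFiltration.2 fun v hv => by
    rw [List.length_eq_zero_iff.1 hv, smul_nil]

theorem label_mul (g h : iteratedWreath H) (v : List (Fin m)) :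
    label (g * h) v = label g (h • v) * label h v :=
  label_eq fun x => by rw [mul_smul, mul_smul, smul_concat, smul_concat]; rfl

theorem label_eq_label_sec (g : iteratedWreath H) (v : List (Fin m)) :
    label g v = label (sec g v) [] :=
  label_eq fun x => by rw [smul_append, ← List.nil_append [x], smul_concat]; simp

@[simp]
theorem label_one (v : List (Fin m)) : label (1 : iteratedWreath H) v = 1 :=
  label_eq fun x => by simp

/-- The labels at level `n` of the elements of `K` that stabilize this level. -/
noncomputable def levelLabelHom (K : Subgroup (iteratedWreath H)) (n : ℕ) :
    ↥(levelFiltration H n ⊓ K) →* (List.Vector (Fin m) n → H) where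
  toFun g v := label g.1 v.1
  map_one' := funext fun v => label_one v.1
  map_mul' g h := funext fun v => by
    rw [Subgroup.coe_mul, label_mul, mem_levelFiltration.1 h.2.1 v.1 v.2]; rfl

theorem ker_levelLabelHom (K : Subgroup (iteratedWreath H)) (n : ℕ) :
    (levelLabelHom K n).ker =
      (levelFiltration H (n + 1)).subgroupOf (levelFiltration H n ⊓ K) := by
  ext g
  rw [MonoidHom.mem_ker, Subgroup.mem_subgroupOf, mem_levelFiltration]
  have hg := mem_levelFiltration.1 g.2.1
  constructor
  · intro h v hv
    rcases List.eq_nil_or_concat v with rfl | ⟨w, x, rfl⟩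
    · simp at hv
    · rw [List.concat_eq_append] at hv ⊢
      have hw : w.length = n := by simpa using hv
      have := congrFun h ⟨w, hw⟩
      rw [smul_concat, hg w hw, show label g.1 w = 1 from this]
      simp
  · intro h
    refine funext fun v => label_eq fun x => ?_
    rw [h _ (by simp [v.2]), hg v.1 v.2]
    simp

/-- Successive quotients of the stabilizers in `K` are the images of the label homomorphisms, by
`ker_levelLabelHom`. -/
theorem levelFiltration_relIndex (K : Subgroup (iteratedWreath H)) (n : ℕ) :
    (levelFiltration H n).relIndex K =
      ∏ k ∈ Finset.range n, Nat.card (levelLabelHom K k).range := by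
  induction n with
  | zero => simp [levelFiltration_zero]
  | succ n ih =>
    rw [Finset.prod_range_succ, ← ih, ← Subgroup.index_ker, ker_levelLabelHom,
      ← Subgroup.inf_relIndex_right (levelFiltration H (n + 1)) K,
      ← Subgroup.relIndex_mul_relIndex _ _ _
        (inf_le_inf_right K (levelFiltration_antitone n.le_succ)) inf_le_right,
      Subgroup.inf_relIndex_right (levelFiltration H n) K, mul_comm]
    congr 1
    rw [← Subgroup.inf_relIndex_right, ← Subgroup.relIndex,
      ← Subgroup.inf_relIndex_right (levelFiltration H (n + 1))]
    congr 1
    rw [inf_assoc]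
    congr 1
    rw [inf_comm K, inf_assoc, inf_idem]

theorem card_vector (n : ℕ) : Nat.card (List.Vector (Fin m) n) = m ^ n := by
  rw [Nat.card_eq_fintype_card, _root_.card_vector, Fintype.card_fin]

theorem levelFiltration_index_le (n : ℕ) :
    (levelFiltration H n).index ≤ Nat.card H ^ ∑ k ∈ Finset.range n, m ^ k := by
  rw [← Subgroup.relIndex_top_right, levelFiltration_relIndex, ← Finset.prod_pow_eq_pow_sum]
  refine Finset.prod_le_prod' fun k _ => ?_
  rw [← card_vector k, ← Nat.card_fun]
  exact Nat.card_le_card_of_injective _ Subtype.val_injective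

theorem levelFiltration_index_ne_zero (n : ℕ) : (levelFiltration H n).index ≠ 0 := by
  rw [← Subgroup.relIndex_top_right, levelFiltration_relIndex]
  exact Finset.prod_ne_zero_iff.2 fun k _ => Nat.card_pos.ne'

end Levels

end iteratedWreath

/-! ### From label counts to Hausdorff dimension -/

open Filter Topology Asymptotics in
theorem hausdorffDim_levelFiltration_eq_one {m : ℕ} (hm : 2 ≤ m)
    {H : Subgroup (Equiv.Perm (Fin m))} (hH : 1 < Nat.card H) {K L : Subgroup (iteratedWreath H)}
    (hKL : K ≤ L) {r : ℕ → ℕ} (hr : Tendsto r atTop atTop)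
    (hK : ∀ᶠ n in atTop, Nat.card H ^ (m ^ n - m ^ n / (r n + 1)) ≤
      Nat.card (iteratedWreath.levelLabelHom K n).range) :
    hausdorffDim (levelFiltration H) L = 1 := by
  classical
  have hlog : 0 < Real.log (Nat.card H) := Real.log_pos (by exact_mod_cast hH)
  -- The defect at level `n`, set to the trivial value `m ^ n` at the finitely many levels where the
  -- bound may fail.
  let d : ℕ → ℕ := fun n => if Nat.card H ^ (m ^ n - m ^ n / (r n + 1)) ≤
    Nat.card (iteratedWreath.levelLabelHom K n).range then m ^ n / (r n + 1) else m ^ n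
  have hdle : ∀ n, d n ≤ m ^ n := by
    intro n
    simp only [d]
    split_ifs
    · exact Nat.div_le_self _ _
    · exact le_rfl
  have hcard : ∀ n, Nat.card H ^ (m ^ n - d n) ≤
      Nat.card (iteratedWreath.levelLabelHom K n).range := by
    intro n
    simp only [d]
    split_ifs with h
    · exact h
    · rw [Nat.sub_self, pow_zero]
      exact Nat.card_pos
  have hmpos : ∀ n, (0 : ℝ) < (m : ℝ) ^ n := fun n => by positivity
  have ho : (fun n => (d n : ℝ)) =o[atTop] fun n => (m : ℝ) ^ n := by
    rw [isLittleO_iff]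
    intro c hc
    obtain ⟨N, hN⟩ := exists_nat_gt (1 / c)
    filter_upwards [hK, hr.eventually_ge_atTop N] with n hn hrn
    have h1 : (d n : ℝ) ≤ (m : ℝ) ^ n / ((r n : ℝ) + 1) := by
      simp only [d, if_pos hn]
      exact_mod_cast Nat.cast_div_le (α := ℝ) (m := m ^ n) (n := r n + 1)
    have h2 : 1 / c < (r n : ℝ) + 1 := by
      have : (N : ℝ) ≤ r n := by exact_mod_cast hrn
      linarith
    rw [Real.norm_of_nonneg (Nat.cast_nonneg _), Real.norm_of_nonneg (hmpos n).le]
    refine h1.trans ?_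
    rw [div_le_iff₀ (by positivity)]
    rw [div_lt_iff₀ hc] at h2
    nlinarith [hmpos n]
  have hsum : Tendsto (fun n => ∑ k ∈ Finset.range n, (m : ℝ) ^ k) atTop atTop := by
    refine tendsto_atTop_mono (fun n => ?_) tendsto_natCast_atTop_atTop
    calc (n : ℝ) = ∑ k ∈ Finset.range n, (1 : ℝ) := by simp
      _ ≤ _ := Finset.sum_le_sum fun k _ => one_le_pow₀ (by exact_mod_cast (by omega : 1 ≤ m))
  have ho' := (ho.sum_range (fun n => (hmpos n).le) hsum).tendsto_div_nhds_zero
  have hlow : Tendsto (fun n => 1 - (∑ k ∈ Finset.range n, (d k : ℝ)) /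
      ∑ k ∈ Finset.range n, (m : ℝ) ^ k) atTop (𝓝 1) := by
    simpa using tendsto_const_nhds (x := (1 : ℝ)).sub ho'
  have hindex : ∀ n, (levelFiltration H n).relIndex (L ⊔ levelFiltration H n) ≤
      (levelFiltration H n).index := by
    intro n
    rw [← Subgroup.relIndex_top_right]
    refine Subgroup.relIndex_le_of_le_right le_top ?_
    rw [Subgroup.relIndex_top_right]
    exact iteratedWreath.levelFiltration_index_ne_zero n
  have hfin : ∀ n, (levelFiltration H n).relIndex (L ⊔ levelFiltration H n) ≠ 0 := fun n h =>
    iteratedWreath.levelFiltration_index_ne_zero n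
      (by rw [← Subgroup.relIndex_top_right]; exact Subgroup.relIndex_eq_zero_of_le_right le_top h)
  have hloglog : ∀ n, Real.log ((levelFiltration H n).relIndex (L ⊔ levelFiltration H n)) ≤
      Real.log (levelFiltration H n).index := fun n =>
    Real.log_le_log (by exact_mod_cast Nat.pos_of_ne_zero (hfin n)) (by exact_mod_cast hindex n)
  refine (tendsto_of_tendsto_of_tendsto_of_le_of_le' hlow tendsto_const_nhds ?_ ?_).liminf_eq
  · filter_upwards [eventually_gt_atTop 0] with n hn
    have hS : 0 < ∑ k ∈ Finset.range n, (m : ℝ) ^ k :=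
      Finset.sum_pos (fun k _ => hmpos k) ⟨0, by simpa using hn⟩
    have h1 : Nat.card H ^ ∑ k ∈ Finset.range n, (m ^ k - d k) ≤
        (levelFiltration H n).relIndex (L ⊔ levelFiltration H n) := by
      refine le_trans ?_ (Subgroup.relIndex_le_of_le_right (hKL.trans le_sup_left) (hfin n))
      rw [iteratedWreath.levelFiltration_relIndex, ← Finset.prod_pow_eq_pow_sum]
      exact Finset.prod_le_prod' fun k _ => hcard k
    have h2 : (∑ k ∈ Finset.range n, (m : ℝ) ^ k - ∑ k ∈ Finset.range n, (d k : ℝ)) *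
        Real.log (Nat.card H) ≤
          Real.log ((levelFiltration H n).relIndex (L ⊔ levelFiltration H n)) := by
      have := Real.log_le_log (by positivity) (Nat.cast_le (α := ℝ).2 h1)
      rw [Nat.cast_pow, Real.log_pow, Nat.cast_sum] at this
      refine le_trans (le_of_eq ?_) this
      rw [← Finset.sum_sub_distrib]
      congr 1
      exact Finset.sum_congr rfl fun k _ => by rw [Nat.cast_sub (hdle k), Nat.cast_pow]
    have h3 : Real.log (levelFiltration H n).index ≤
        (∑ k ∈ Finset.range n, (m : ℝ) ^ k) * Real.log (Nat.card H) := by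
      have := Real.log_le_log
        (by exact_mod_cast Nat.pos_of_ne_zero (iteratedWreath.levelFiltration_index_ne_zero n))
        (Nat.cast_le (α := ℝ).2 (iteratedWreath.levelFiltration_index_le (H := H) n))
      rw [Nat.cast_pow, Real.log_pow, Nat.cast_sum] at this
      exact_mod_cast this
    have h4 : ∑ k ∈ Finset.range n, (d k : ℝ) ≤ ∑ k ∈ Finset.range n, (m : ℝ) ^ k :=
      Finset.sum_le_sum fun k _ => by exact_mod_cast hdle k
    set S := ∑ k ∈ Finset.range n, (m : ℝ) ^ k
    set D := ∑ k ∈ Finset.range n, (d k : ℝ)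
    have h5 : 1 - D / S = (S - D) / S := by rw [sub_div, div_self hS.ne']
    rw [h5]
    -- If the denominator is zero, the quotient is 0 by convention and the lower bound is
    -- nonpositive.
    rcases (Real.log_natCast_nonneg (levelFiltration H n).index).eq_or_lt with h0 | h0
    · have h6 : (S - D) * Real.log (Nat.card H) ≤ 0 := (h2.trans (hloglog n)).trans h0.ge
      rw [← h0, div_zero]
      exact div_nonpos_of_nonpos_of_nonneg (nonpos_of_mul_nonpos_left h6 hlog) hS.le
    · rw [le_div_iff₀ h0]
      calc (S - D) / S * Real.log (levelFiltration H n).index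
          ≤ (S - D) / S * (S * Real.log (Nat.card H)) :=
            mul_le_mul_of_nonneg_left h3 (div_nonneg (sub_nonneg.2 h4) hS.le)
        _ = (S - D) * Real.log (Nat.card H) := by field_simp
        _ ≤ _ := h2
  · filter_upwards with n
    exact div_le_one_of_le₀ (hloglog n) (Real.log_natCast_nonneg _)

namespace iteratedWreath

/-! ### The directed generator and commutators of its powers -/

section Directed

variable {m : ℕ} {H : Subgroup (Equiv.Perm (Fin m))}

/-- Bounds the depth spent on extracting roots linearly in the exponent. -/
theorem length_primeFactorsList_pow_div_le (c k p : ℕ) :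
    (c ^ k / p).primeFactorsList.length ≤ c * k := by
  rcases Nat.eq_zero_or_pos (c ^ k / p) with h0 | h0
  · simp [h0]
  have key : ∀ L : List ℕ, (∀ q ∈ L, 2 ≤ q) → 2 ^ L.length ≤ L.prod := by
    intro L hL
    induction L with
    | nil => simp
    | cons q L ih =>
      rw [List.length_cons, List.prod_cons, pow_succ, mul_comm]
      exact Nat.mul_le_mul (hL q List.mem_cons_self)
        (ih fun q hq => hL q (List.mem_cons_of_mem _ hq))
  have h1 := key (c ^ k / p).primeFactorsList
    fun q hq => (Nat.prime_of_mem_primeFactorsList hq).two_le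
  rw [Nat.prod_primeFactorsList h0.ne'] at h1
  refine (Nat.pow_le_pow_iff_right (a := 2) (by norm_num)).1 ?_
  calc 2 ^ (c ^ k / p).primeFactorsList.length ≤ c ^ k := h1.trans (Nat.div_le_self _ _)
    _ ≤ (2 ^ c) ^ k := Nat.pow_le_pow_left Nat.lt_two_pow_self.le k
    _ = 2 ^ (c * k) := (pow_mul _ _ _).symm

theorem pow_natCard_eq_one (h : H) : h ^ Nat.card H = 1 :=
  pow_card_eq_one'

/-- Every element of exponent `|H|` is the section at some vertex `π` of the power with exponent
`|H| ^ (i + 1)` of an element with label `a` at the root. -/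
theorem exists_node_root {a : H} {x : Fin m} {p : ℕ} (hp : p.Prime) (hd : p ∣ Nat.card H)
    (ha : a ^ p = 1) (hx : (a : Equiv.Perm (Fin m)) x ≠ x) {φ : iteratedWreath H}
    (hφ : φ ^ Nat.card H = 1) (i : ℕ) :
    ∃ (e : iteratedWreath H) (π : List (Fin m)),
      π.length = (Nat.card H ^ (i + 1) / p).primeFactorsList.length + 1 ∧
      node a (Pi.mulSingle x e) ^ Nat.card H ^ (i + 1) • π = π ∧
      sec (node a (Pi.mulSingle x e) ^ Nat.card H ^ (i + 1)) π = φ ∧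
      node a (Pi.mulSingle x e) ^ Nat.card H ^ (i + 2) = 1 := by
  have hdN : p ∣ Nat.card H ^ (i + 1) := dvd_pow hd i.succ_ne_zero
  have hmul : p * (Nat.card H ^ (i + 1) / p) = Nat.card H ^ (i + 1) := Nat.mul_div_cancel' hdN
  have hne : Nat.card H ^ (i + 1) / p ≠ 0 := by
    intro h0
    rw [h0, mul_zero] at hmul
    exact pow_ne_zero (i + 1) Nat.card_pos.ne' hmul.symm
  obtain ⟨e, π, h1, h2, h3, h4⟩ := exists_root hφ (Nat.card H ^ (i + 1) / p).primeFactorsList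
    fun q hq => by
      have hq' := Nat.prime_of_mem_primeFactorsList hq
      exact ⟨hq', hq'.dvd_of_dvd_pow
        ((Nat.dvd_of_mem_primeFactorsList hq).trans (Nat.div_dvd_of_dvd hdN))⟩
  rw [Nat.prod_primeFactorsList hne] at h2 h3 h4
  obtain ⟨h5, h6, h7⟩ := node_mulSingle_root hp ha hx h2 h3 h4
  rw [hmul] at h5 h6 h7
  exact ⟨e, x :: π, by simp [h1], h5, h6, by rwa [pow_succ]⟩

/-- There is a directed element `b` which together with the rooted elements generates a
level-transitive group, and whose power with exponent `|H| ^ (i + 1)` is supported below the vertex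
of level `J i` of the ray and has there a vertex `π i` below which it carries a comb of prescribed
labels `lab i s` at prescribed depths. -/
theorem exists_directed {o x₁ : Fin m} (hne : x₁ ≠ o) {a : H} {p : ℕ} (hp : p.Prime)
    (hd : p ∣ Nat.card H) (ha : a ^ p = 1) (hao : (a : Equiv.Perm (Fin m)) o = x₁)
    (htr : ∀ x, ∃ h : H, (h : Equiv.Perm (Fin m)) o = x) {J : ℕ → ℕ} (hJ : StrictMono J)
    (D : ℕ → ℕ → ℕ) (lab : ℕ → ℕ → H) :
    ∃ (b : iteratedWreath H) (Y : ℕ → iteratedWreath H) (π : ℕ → List (Fin m)),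
      (∀ S : Subgroup (iteratedWreath H), b ∈ S → (∀ h : H, rooted h ∈ S) → ∀ v : List (Fin m),
        ∃ c ∈ S, c • List.replicate v.length o = v ∧ sec c (List.replicate v.length o) = 1) ∧
      (∀ i, (π i).length = (Nat.card H ^ (i + 1) / p).primeFactorsList.length + 2) ∧
      (∀ i, b ^ Nat.card H ^ (i + 1) = atVertex (List.replicate (J i) o) (Y i)) ∧
      ∀ i s, Y i • (π i ++ (List.replicate s o ++ [x₁])) = π i ++ (List.replicate s o ++ [x₁]) ∧
        sec (Y i) (π i ++ (List.replicate s o ++ [x₁])) =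
          atVertex (List.replicate (D i s) o) (rooted (lab i s)) := by
  classical
  have hrooted : ∀ (h : H) (n : ℕ), Nat.card H ∣ n → rooted h ^ n = 1 := by
    rintro h _ ⟨k, rfl⟩
    rw [← map_pow, pow_mul, pow_natCard_eq_one, one_pow, map_one]
  -- The `i`-th comb, itself directed along the ray; its exponent divides |H|.
  let C : ℕ → ℕ → Fin m → iteratedWreath H := fun i s x =>
    if x = x₁ then atVertex (List.replicate (D i s) o) (rooted (lab i s)) else 1
  have hC : ∀ i, spine o (C i) 0 ^ Nat.card H = 1 := by
    intro i
    rw [spine_pow, ← spine_one o 0]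
    congr 1
    funext s x
    simp only [C]
    split_ifs
    · rw [← map_pow, hrooted _ _ dvd_rfl, map_one]; rfl
    · exact one_pow _
  have hax : (a : Equiv.Perm (Fin m)) x₁ ≠ x₁ := fun h =>
    hne ((a : Equiv.Perm (Fin m)).injective (h.trans hao.symm))
  choose e π h1 h2 h3 h4 using fun i => exists_node_root hp hd ha hax (hC i) i
  choose t ht using htr
  let E : ℕ → iteratedWreath H := Function.extend J e 1
  -- The root label `a` at the branch `x₁` serves twice: it carries `o` to `x₁`, as transitivity
  -- requires, and it moves `x₁`, as root extraction requires.
  let F : ℕ → Fin m → iteratedWreath H := fun j x =>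
    if x = x₁ then node a (Pi.mulSingle x₁ (E j)) else rooted (t x)
  have hFJ : ∀ i, F (J i) x₁ = node a (Pi.mulSingle x₁ (e i)) := by
    intro i
    simp only [F, if_pos, E, hJ.injective.extend_apply]
  -- The root planted at depth `J i'` has exponent |H|^(i'+2), which divides |H|^(i+1) for i' < i;
  -- the other branches have exponent |H|.
  have hF1 : ∀ i, ∀ j < J i, ∀ x, F j x ^ Nat.card H ^ (i + 1) = 1 := by
    intro i j hj x
    have hdvd : Nat.card H ∣ Nat.card H ^ (i + 1) := dvd_pow_self _ i.succ_ne_zero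
    by_cases hx : x = x₁
    · subst hx
      by_cases hj' : ∃ i', J i' = j
      · obtain ⟨i', rfl⟩ := hj'
        obtain ⟨k, hk⟩ := pow_dvd_pow (Nat.card H)
          (Nat.succ_le_succ (Nat.succ_le_of_lt (hJ.lt_iff_lt.1 hj)))
        rw [hFJ, Nat.succ_eq_add_one i] at *
        rw [hk, pow_mul, h4, one_pow]
      · obtain ⟨k, hk⟩ := hd.trans hdvd
        simp only [F, if_pos, E, Function.extend_apply' _ _ _ hj']
        have h5 := node_mulSingle_pow_eq_one (x := x) ha
          (one_pow 1 : (1 : iteratedWreath H) ^ 1 = 1)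
        rw [mul_one] at h5
        rw [hk, pow_mul, Pi.one_apply, h5, one_pow]
    · simp only [F, if_neg hx]
      exact hrooted _ _ hdvd
  have hFo : ∀ j, ∀ x ≠ o, F j x • [o] = [x] ∧ sec (F j x) [o] = 1 := by
    intro j x _
    by_cases hx : x = x₁
    · subst hx
      simp [F, hao, Pi.mulSingle_eq_of_ne hne.symm]
    · simp [F, hx, ht, sec_rooted]
  refine ⟨spine o F 0, fun i => spine o (fun j x => F j x ^ Nat.card H ^ (i + 1)) (J i),
    fun i => x₁ :: π i, ?_, fun i => by simp [h1], fun i => ?_, fun i s => ?_⟩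
  · intro S hb hS v
    exact exists_smul_replicate_eq hFo v.length 0 S hb
      (fun x => ⟨rooted (t x), hS _, by simp [ht], sec_rooted _ _ _⟩) v rfl
  · rw [spine_pow, spine_eq_atVertex o 0 (J i) fun j hj x _ => by
      rw [zero_add]; exact hF1 i j hj x, zero_add]
  · have h5 := spine_smul_replicate_append hne (C i) 0 s
    rw [zero_add] at h5
    change spine o (fun j x => F j x ^ Nat.card H ^ (i + 1)) (J i) •
      ([x₁] ++ (π i ++ (List.replicate s o ++ [x₁]))) =
        [x₁] ++ (π i ++ (List.replicate s o ++ [x₁])) ∧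
      sec (spine o (fun j x => F j x ^ Nat.card H ^ (i + 1)) (J i))
        ([x₁] ++ (π i ++ (List.replicate s o ++ [x₁]))) = _
    rw [smul_append, sec_append, spine_smul_singleton,
      sec_spine_of_ne hne, hFJ, smul_append, sec_append, h2, h3, h5.1, h5.2]
    exact ⟨rfl, by simp [C]⟩

/-- The commutator of an element `X` moving one subtree with a conjugate of an element supported
below `w`. -/
theorem commutator_mem {S : Subgroup (iteratedWreath H)} {o x₁ : Fin m} {a h : H}
    (hao : (a : Equiv.Perm (Fin m)) o = x₁)
    (hS : ∀ v : List (Fin m), ∃ c ∈ S, c • List.replicate v.length o = v ∧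
      sec c (List.replicate v.length o) = 1)
    {X Y : iteratedWreath H} {y u w : List (Fin m)} {d e k : ℕ} (hX : X ∈ S)
    (hXy : X • y = y)
    (hXsec : sec X y = atVertex (List.replicate (d + (u.length + e)) o) (rooted a))
    (hw : w.length = y.length + d) (hY : atVertex w Y ∈ S) (hYu : Y • u = u)
    (hYsec : sec Y u = atVertex (List.replicate (e + (k + 1)) o) (rooted h)) :
    atVertex (y ++ List.replicate (d + (u.length + e)) o ++ x₁ :: List.replicate k o) (rooted h) *
      (atVertex (y ++ List.replicate (d + (u.length + e)) o ++ o :: List.replicate k o)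
        (rooted h))⁻¹ ∈ S := by
  -- One element aligns everything: `w` goes to `y o^d`, and the vertex of `Y` above its label `h`
  -- goes to the vertex where `X` acts by `a`. Its trivial section at the end keeps `h` intact.
  obtain ⟨c, hc, hcs, hc1⟩ := exists_smul_eq_and_sec_eq_one hS
    (u := w ++ ((u ++ List.replicate e o) ++ List.replicate (k + 1) o))
    (v := (y ++ List.replicate d o) ++ (List.replicate (u.length + e) o ++
      List.replicate (k + 1) o)) (by simp [hw]; omega)
  rw [smul_append] at hcs
  obtain ⟨hcw, hcs⟩ := List.append_inj hcs (by simp [hw])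
  rw [smul_append] at hcs
  obtain ⟨hcu, hck⟩ := List.append_inj hcs (by simp)
  rw [sec_append, sec_append] at hc1
  have hXw : X • (y ++ List.replicate d o) = y ++ List.replicate d o := by
    rw [smul_append, hXy, hXsec, List.replicate_add, atVertex_append, atVertex_smul_self]
  have hXsw : sec X (y ++ List.replicate d o) =
      atVertex (List.replicate (u.length + e) o) (rooted a) := by
    rw [sec_append, hXsec, List.replicate_add, sec_atVertex_append]
  have hYu' : Y • (u ++ List.replicate e o) = u ++ List.replicate e o := by
    rw [smul_append, hYu, hYsec, List.replicate_add, atVertex_append, atVertex_smul_self]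
  have hYsu : sec Y (u ++ List.replicate e o) =
      atVertex (List.replicate (k + 1) o) (rooted h) := by
    rw [sec_append, hYsec, List.replicate_add, sec_atVertex_append]
  set l := sec c w with hl
  have hlu : l⁻¹ • List.replicate (u.length + e) o = u ++ List.replicate e o := by
    rw [inv_smul_eq_iff, hcu]
  have hZ : (l * Y * l⁻¹) • List.replicate (u.length + e) o =
      List.replicate (u.length + e) o := by
    rw [mul_smul, mul_smul, hlu, hYu', hcu]
  have hZsec : sec (l * Y * l⁻¹) (List.replicate (u.length + e) o) =
      atVertex (List.replicate (k + 1) o) (rooted h) := by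
    rw [sec_mul, sec_mul, hlu, hYu', sec_inv, hlu, hYsu, mul_atVertex, hck, hc1]
    simp
  have hmem : X * (c * atVertex w Y * c⁻¹) * X⁻¹ * (c * atVertex w Y * c⁻¹)⁻¹ ∈ S := by
    have := mul_mem (mul_mem hc hY) (inv_mem hc)
    exact mul_mem (mul_mem (mul_mem hX this) (inv_mem hX)) (inv_mem this)
  -- Localise first to `y o^d`, fixed by `X`, then to `o^(|u|+e)`, fixed by the conjugate of `Y`;
  -- there remains the commutator of `rooted a` with `h` placed at `o^(k+1)`.
  rw [mul_atVertex c, ← hl, hcw, commutator_atVertex hXw, hXsw, atVertex_commutator hZ, hZsec,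
    mul_atVertex, List.replicate_succ, rooted_smul_cons, sec_rooted, hao] at hmem
  simpa only [List.replicate_add, List.append_assoc, atVertex_append, map_mul, map_inv, one_mul,
    inv_one, mul_one] using hmem

end Directed

end iteratedWreath

namespace iteratedWreath

/-! ### Linked vertices and the lower bound at each level -/

section Dense

variable {m : ℕ} {H : Subgroup (Equiv.Perm (Fin m))}

theorem atVertex_smul_of_length_le {v s : List (Fin m)} (h : s.length ≤ v.length)
    (g : iteratedWreath H) : atVertex v g • s = s := by
  by_cases hp : v <+: s
  · rw [← hp.eq_of_length_le h, atVertex_smul_self]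
  · exact atVertex_smul_of_not_prefix hp g

theorem label_atVertex_self (v : List (Fin m)) (g : iteratedWreath H) :
    label (atVertex v g) v = label g [] := by
  rw [label_eq_label_sec, sec_atVertex_self]

theorem label_atVertex_of_ne {v s : List (Fin m)} (h : s.length = v.length) (hne : s ≠ v)
    (g : iteratedWreath H) : label (atVertex v g) s = 1 := by
  refine label_eq fun x => ?_
  rw [atVertex_smul_of_not_prefix, atVertex_smul_of_length_le h.le]
  · rfl
  · intro hp
    exact hne (List.prefix_iff_eq_take.1 hp ▸ by simp [← h])

@[simp]
theorem label_rooted_nil (h : H) : label (rooted h) [] = h :=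
  label_eq fun x => by simp

/-- The given pairs are conjugated so that one of the two vertices becomes `u`; the partner `u'`
branches off at level `z.length`. -/
theorem exists_linked {S : Subgroup (iteratedWreath H)} {o x₁ : Fin m} (hne : x₁ ≠ o)
    (hS : ∀ v : List (Fin m), ∃ c ∈ S, c • List.replicate v.length o = v ∧
      sec c (List.replicate v.length o) = 1) {n k : ℕ} {z : List (Fin m)}
    (hz : z.length + (k + 1) = n)
    (hmem : ∀ h : H, atVertex (z ++ x₁ :: List.replicate k o) (rooted h) *
      (atVertex (z ++ o :: List.replicate k o) (rooted h))⁻¹ ∈ S) (u : List.Vector (Fin m) n) :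
    ∃ u' : List.Vector (Fin m) n, u'.1.take z.length = u.1.take z.length ∧
      u'.1.take (z.length + 1) ≠ u.1.take (z.length + 1) ∧
      Linked (levelLabelHom S n).range u u' ∧ Linked (levelLabelHom S n).range u' u := by
  obtain ⟨c, hc, hcu, hc1⟩ := exists_smul_eq_and_sec_eq_one hS
    (u := z ++ o :: List.replicate k o) (v := u.1) (by rw [u.2, ← hz]; simp)
  set v := z ++ x₁ :: List.replicate k o with hv
  have hvlen : v.length = n := by rw [← hz]; simp [hv]
  let u' : List.Vector (Fin m) n := ⟨c • v, by rw [length_smul, hvlen]⟩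
  have htake : u'.1.take (z.length + 1) ≠ u.1.take (z.length + 1) := by
    rw [← hcu]
    change (c • v).take _ ≠ _
    rw [← smul_take, ← smul_take, (MulAction.injective c).ne_iff, hv, List.take_length_add_append,
      List.take_length_add_append]
    simpa using hne
  have hne' : u' ≠ u := fun h => htake (by rw [h])
  -- The section at the second vertex is not controlled, but it only conjugates the label, so the
  -- links persist both ways.
  set ρ := label (sec c v) []
  have key : ∀ h : H, ∃ f ∈ (levelLabelHom S n).range, f u = h⁻¹ ∧ f u' = ρ * h * ρ⁻¹ ∧
      ∀ w, w ≠ u → w ≠ u' → f w = 1 := by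
    intro h
    set t := atVertex (c • v) (sec c v * rooted h * (sec c v)⁻¹) *
      atVertex u.1 (rooted h⁻¹) with ht
    have htS : t ∈ S := by
      have := mul_mem (mul_mem hc (hmem h)) (inv_mem hc)
      have h1 := mul_atVertex c (z ++ o :: List.replicate k o) (rooted h)⁻¹
      rw [hc1, hcu, one_mul, inv_one, mul_one] at h1
      rw [ht, ← mul_atVertex, map_inv rooted, ← h1]
      convert this using 1
      rw [map_inv]
      group
    have hfix : ∀ w : List.Vector (Fin m) n, atVertex u.1 (rooted h⁻¹) • w.1 = w.1 := fun w =>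
      atVertex_smul_of_length_le (by rw [w.2, u.2]) _
    have htn : t ∈ levelFiltration H n := mem_levelFiltration.2 fun w hw => by
      rw [ht, mul_smul, hfix ⟨w, hw⟩, atVertex_smul_of_length_le (by rw [length_smul, hvlen, hw])]
    have hlab : ∀ w : List.Vector (Fin m) n, levelLabelHom S n ⟨t, htn, htS⟩ w =
        label (atVertex (c • v) (sec c v * rooted h * (sec c v)⁻¹)) w.1 *
          label (atVertex u.1 (rooted h⁻¹)) w.1 := fun w => by
      change label t w.1 = _
      rw [ht, label_mul, hfix]
    have hlab' : ∀ w : List.Vector (Fin m) n, w ≠ u →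
        label (atVertex u.1 (rooted h⁻¹)) w.1 = 1 := fun w hw =>
      label_atVertex_of_ne (by rw [w.2, u.2]) (fun h' => hw (Subtype.ext h')) _
    have hlab'' : ∀ w : List.Vector (Fin m) n, w ≠ u' →
        label (atVertex (c • v) (sec c v * rooted h * (sec c v)⁻¹)) w.1 = 1 := fun w hw =>
      label_atVertex_of_ne (by rw [w.2, length_smul, hvlen]) (fun h' => hw (Subtype.ext h')) _
    refine ⟨_, ⟨⟨t, htn, htS⟩, rfl⟩, ?_, ?_, fun w h1 h2 => ?_⟩
    · rw [hlab, hlab'' u hne'.symm, label_atVertex_self, label_rooted_nil, one_mul]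
    · have h3 : label (sec c v)⁻¹ [] = ρ⁻¹ := by
        rw [eq_inv_iff_mul_eq_one, ← label_one (H := H) [], ← inv_mul_cancel (sec c v), label_mul,
          smul_nil]
      rw [hlab, hlab' u' hne', mul_one, label_atVertex_self, label_mul, label_mul, smul_nil,
        smul_nil, label_rooted_nil, h3]
    · rw [hlab, hlab' w h1, hlab'' w h2, mul_one]
  refine ⟨u', ?_, htake, fun h => ?_, fun h => ?_⟩
  · rw [← hcu]
    change (c • v).take _ = _
    rw [← smul_take, ← smul_take, hv, List.take_left, List.take_left]
  · obtain ⟨f, hf, h1, -, h3⟩ := key h⁻¹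
    exact ⟨f, hf, by rw [h1, inv_inv], h3⟩
  · obtain ⟨f, hf, -, h2, h3⟩ := key (ρ⁻¹ * h * ρ)
    exact ⟨f, hf, by rw [h2]; group, fun w h4 h5 => h3 w h5 h4⟩

/-- Lower bound for the number of labels at level `n`, from subtrees branching at `r` levels. -/
theorem pow_le_card_levelLabelHom_range {S : Subgroup (iteratedWreath H)} {o x₁ : Fin m}
    (hne : x₁ ≠ o)
    (hS : ∀ v : List (Fin m), ∃ c ∈ S, c • List.replicate v.length o = v ∧
      sec c (List.replicate v.length o) = 1) {n r : ℕ} {ℓ : Fin r → ℕ}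
    (hℓ : Function.Injective ℓ)
    (hmem : ∀ s, ∃ (z : List (Fin m)) (k : ℕ), z.length = ℓ s ∧ z.length + (k + 1) = n ∧
      ∀ h : H, atVertex (z ++ x₁ :: List.replicate k o) (rooted h) *
        (atVertex (z ++ o :: List.replicate k o) (rooted h))⁻¹ ∈ S) :
    Nat.card H ^ (m ^ n - m ^ n / (r + 1)) ≤ Nat.card (levelLabelHom S n).range := by
  have hlinks : ∀ (u : List.Vector (Fin m) n) (s : Fin r), ∃ u' : List.Vector (Fin m) n,
      u'.1.take (ℓ s) = u.1.take (ℓ s) ∧ u'.1.take (ℓ s + 1) ≠ u.1.take (ℓ s + 1) ∧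
      Linked (levelLabelHom S n).range u u' ∧ Linked (levelLabelHom S n).range u' u := by
    intro u s
    obtain ⟨z, k, hz, hk, h⟩ := hmem s
    rw [← hz]
    exact exists_linked hne hS hk h u
  choose ν h1 h2 h3 using hlinks
  rw [← card_vector (m := m) n]
  refine pow_le_card_of_linked fun u => ⟨ν u, fun s t hst => ?_, fun s => ⟨fun h => ?_, h3 u s⟩⟩
  · have key : ∀ s t, ν u s = ν u t → ¬ ℓ s < ℓ t := by
      intro s t hst hlt
      apply h2 u s
      have := congrArg (List.take (ℓ s + 1)) (h1 u t)
      rwa [List.take_take, List.take_take, min_eq_left (Nat.succ_le_of_lt hlt), ← hst] at this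
    exact hℓ (le_antisymm (not_lt.1 (key t s hst.symm)) (not_lt.1 (key s t hst)))
  · exact h2 u s (by rw [h])

/-- With I = i + 1, the left side adds the depth J I, the bounds for the root path and for the tooth
index of comb I, and the small offsets; the right side is the level just below the branching levels.
-/
theorem sparse_levels_bound {c I : ℕ} (hI : 10 * c + 10 ≤ I) :
    (c + 3) * I ^ 2 + (c * (I + 1) + 2) + (I + c * (2 * (c + 3) * (2 * I + 1))) + 1 + (1 + I) ≤
      2 * (c + 3) * I ^ 2 := by
  obtain ⟨t, rfl⟩ := Nat.exists_eq_add_of_le hI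
  ring_nf
  nlinarith [Nat.zero_le (c * t), Nat.zero_le (c * t ^ 2), Nat.zero_le (c ^ 2 * t),
    Nat.zero_le (c ^ 3), Nat.zero_le (c ^ 2), Nat.zero_le t, Nat.zero_le (t ^ 2)]

end Dense

end iteratedWreath

/-! ### Choice of parameters and conclusion -/

open Filter Topology iteratedWreath in
/-- A transitive group and one directed element generate a subgroup of Hausdorff dimension one. -/
theorem exists_hausdorffDim_eq_one {m : ℕ} (hm : 2 ≤ m) (H : Subgroup (Equiv.Perm (Fin m)))
    (hH : MulAction.IsPretransitive H (Fin m)) :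
    ∃ b : iteratedWreath H, ∀ K L : Subgroup (iteratedWreath H), b ∈ K →
      (∀ h : H, rooted h ∈ K) → K ≤ L → hausdorffDim (levelFiltration H) L = 1 := by
  have htr : ∀ x y : Fin m, ∃ h : H, (h : Equiv.Perm (Fin m)) x = y := fun x y =>
    hH.exists_smul_eq x y
  have hcard : 1 < Nat.card H := by
    obtain ⟨h, hh⟩ := htr ⟨0, by omega⟩ ⟨1, by omega⟩
    have : Nontrivial H := ⟨h, 1, by rintro rfl; simp at hh⟩
    exact Finite.one_lt_card
  obtain ⟨p, hp, hd⟩ := Nat.exists_prime_and_dvd hcard.ne'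
  obtain ⟨a, o, ha, hao⟩ := exists_pow_eq_one_and_apply_ne hp hd
  set c := Nat.card H with hc
  let idx : H ≃ Fin c := Finite.equivFin H
  let J : ℕ → ℕ := fun i => (c + 3) * i ^ 2
  let q : ℕ → ℕ := fun i => (c ^ (i + 1) / p).primeFactorsList.length + 2
  -- The subtracted term is the level where tooth `s` leaves the comb, so the bracket is the
  -- absolute level of its label. Teeth s < i carry `a` at `i` consecutive levels just above
  -- 2(c+3)(i+1)²; the later ones run through the levels from 2(c+3)i² down the tree, with `c` teeth
  -- per level, one for each element of H.
  let D : ℕ → ℕ → ℕ := fun i s =>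
    (if s < i then 2 * (c + 3) * (i + 1) ^ 2 - 1 - s else 2 * (c + 3) * i ^ 2 + (s - i) / c) -
      (J i + (q i + (s + 1)))
  let lab : ℕ → ℕ → H := fun i s =>
    if s < i then a else idx.symm ⟨(s - i) % c, Nat.mod_lt _ (by omega)⟩
  have hJ : StrictMono J := fun i j hij =>
    Nat.mul_lt_mul_of_pos_left (Nat.pow_lt_pow_left hij two_ne_zero) (by omega)
  obtain ⟨b, Y, π, hb, hπ, hY, hYπ⟩ := exists_directed hao hp hd ha rfl (htr o) hJ D lab
  refine ⟨b, fun K L hbK hrK hKL => ?_⟩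
  have hπ' : ∀ i, (π i).length = q i := hπ
  have hq : ∀ i, q i ≤ c * (i + 1) + 2 := fun i =>
    Nat.add_le_add_right (length_primeFactorsList_pow_div_le c (i + 1) p) 2
  -- For large `n`, r n = i means 2(c+3)(i+1)² ≤ n < 2(c+3)(i+2)²: comb `i` supplies the branching
  -- levels and comb i+1 the labels at level `n`.
  let r : ℕ → ℕ := fun n => Nat.sqrt (n / (2 * (c + 3))) - 1
  have hr : Tendsto r atTop atTop := by
    refine tendsto_atTop_atTop.2 fun B => ⟨(B + 1) ^ 2 * (2 * (c + 3)), fun n hn => ?_⟩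
    refine Nat.le_sub_of_add_le (Nat.le_sqrt'.2 ?_)
    rwa [Nat.le_div_iff_mul_le (by omega)]
  refine hausdorffDim_levelFiltration_eq_one hm hcard hKL hr ?_
  filter_upwards [hr.eventually_ge_atTop (10 * c + 10)] with n hn
  obtain ⟨i, hi⟩ : ∃ i, r n = i := ⟨_, rfl⟩
  have hsqrt : Nat.sqrt (n / (2 * (c + 3))) = i + 1 := by
    simp only [r] at hi hn
    omega
  rw [hi] at hn ⊢
  have hlow : 2 * (c + 3) * (i + 1) ^ 2 ≤ n := by
    rw [mul_comm, ← Nat.le_div_iff_mul_le (by omega), ← Nat.le_sqrt', hsqrt]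
  have hupp : n < 2 * (c + 3) * (i + 1) ^ 2 + 2 * (c + 3) * (2 * (i + 1) + 1) := by
    have : n / (2 * (c + 3)) < (i + 2) ^ 2 := by rw [← Nat.sqrt_lt', hsqrt]; omega
    rw [Nat.div_lt_iff_lt_mul (by omega)] at this
    linarith
  have hbound := sparse_levels_bound (c := c) (I := i + 1) (by omega)
  have hq0 := hq i
  have hq1 := hq (i + 1)
  -- The teeth of comb `i` that are used leave it no deeper than the start of comb i+1, so the
  -- support of the next power fits below them.
  have hJi : J i + (q i + (i + 1)) ≤ J (i + 1) := by
    simp only [J]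
    nlinarith
  have htrans := hb K hbK hrK
  refine pow_le_card_levelLabelHom_range (ℓ := fun s : Fin i => 2 * (c + 3) * (i + 1) ^ 2 - 1 - s)
    hao htrans (fun s t hst => ?_) fun s => ?_
  · have h1 := s.2
    have h2 := t.2
    simp only at hst
    refine Fin.ext ?_
    omega
  · obtain ⟨s, hs⟩ := s
    set x := 2 * (c + 3) * (i + 1) ^ 2 - 1 - s with hx
    have hDi : D i s = x - (J i + (q i + (s + 1))) := by simp [D, hs, hx]
    have hlabi : lab i s = a := by simp [lab, hs]
    have hJI : J (i + 1) = (c + 3) * (i + 1) ^ 2 := rfl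
    set y := List.replicate (J i) o ++
      (π i ++ (List.replicate s o ++ [(a : Equiv.Perm (Fin m)) o])) with hy
    have hylen : y.length = J i + (q i + (s + 1)) := by simp [hy, hπ']
    have hXy : b ^ c ^ (i + 1) • y = y := by
      rw [hY, hy, atVertex_smul_append, (hYπ i s).1]
    have hXsec : sec (b ^ c ^ (i + 1)) y = atVertex (List.replicate (D i s) o) (rooted a) := by
      rw [hY, hy, sec_append, sec_atVertex_self, (hYπ i s).2, hlabi]
    refine ⟨y ++ List.replicate (D i s) o, n - x - 1, ?_, ?_, fun h => ?_⟩
    · rw [List.length_append, List.length_replicate, hylen, hDi]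
      omega
    · rw [List.length_append, List.length_replicate, hylen, hDi]
      omega
    · set A := n - 2 * (c + 3) * (i + 1) ^ 2 with hA
      -- The tooth of comb i+1 that carries `h` at level `n`.
      set s' := (i + 1) + (c * A + (idx h : ℕ)) with hs'
      have hih : (idx h : ℕ) < c := (idx h).2
      have hcA : c * (A + 1) ≤ c * (2 * (c + 3) * (2 * (i + 1) + 1)) :=
        Nat.mul_le_mul_left c (by omega)
      rw [mul_add, mul_one] at hcA
      have hsub : s' - (i + 1) = c * A + (idx h : ℕ) := by omega
      have hns : ¬ s' < i + 1 := by omega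
      have hlabI : lab (i + 1) s' = h := by
        simp only [lab, if_neg hns, hsub]
        rw [Equiv.symm_apply_eq]
        exact Fin.ext (by simp [Nat.mod_eq_of_lt hih])
      have hDI : D (i + 1) s' = n - (J (i + 1) + (q (i + 1) + (s' + 1))) := by
        simp only [D, if_neg hns, hsub]
        rw [Nat.mul_add_div (by omega), Nat.div_eq_of_lt hih, add_zero, hA,
          Nat.add_sub_cancel' hlow]
      set u := π (i + 1) ++ (List.replicate s' o ++ [(a : Equiv.Perm (Fin m)) o]) with hu
      have hulen : u.length = q (i + 1) + (s' + 1) := by simp [hu, hπ']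
      have hfit : J (i + 1) + (q (i + 1) + (s' + 1)) ≤ x := by omega
      have hsplit : D i s = (J (i + 1) - y.length) + (u.length + (x - J (i + 1) - u.length)) := by
        omega
      rw [hsplit]
      refine commutator_mem rfl htrans (pow_mem hbK _) hXy (hsplit ▸ hXsec)
        (w := List.replicate (J (i + 1)) o) (Y := Y (i + 1)) ?_ ?_ (hYπ (i + 1) s').1 ?_
      · rw [List.length_replicate]; omega
      · rw [← hY]; exact pow_mem hbK _
      · rw [(hYπ (i + 1) s').2, hlabI]
        congr 3
        omega

theorem mainTheorem7 (m : ℕ) (hm : 2 ≤ m) (H : Subgroup (Equiv.Perm (Fin m)))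
    (hH : MulAction.IsPretransitive H (Fin m)) :
    ∃ K : Subgroup (iteratedWreath H),
      (∃ g : Fin (Group.rank H + 1) → iteratedWreath H, K = Subgroup.closure (Set.range g)) ∧
      hausdorffDim (levelFiltration H) K.topologicalClosure = 1 := by
  obtain ⟨b, hb⟩ := exists_hausdorffDim_eq_one hm H hH
  obtain ⟨S, hScard, hS⟩ := Group.rank_spec H
  let e := (S.equivFinOfCardEq hScard).symm
  let g : Fin (Group.rank H + 1) → iteratedWreath H :=
    Fin.cons b fun k => iteratedWreath.rooted (e k).1
  refine ⟨Subgroup.closure (Set.range g), ⟨g, rfl⟩,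
    hb _ _ ?_ ?_ (Subgroup.le_topologicalClosure _)⟩
  · exact Subgroup.subset_closure ⟨0, rfl⟩
  · have hle : Subgroup.closure (S : Set H) ≤
        (Subgroup.closure (Set.range g)).comap iteratedWreath.rooted := by
      rw [Subgroup.closure_le]
      intro h hh
      refine Subgroup.subset_closure ⟨(e.symm ⟨h, hh⟩).succ, ?_⟩
      simp [g]
    intro h
    exact hle (hS ▸ Subgroup.mem_top h)
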